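/- **Setting.** Consider $\dot x=f(x)+B(x)u$ with $x\in\mathbb R^{n_x}$, $u\in\mathbb R^{n_u}$, where $f$ is unknown and $k+1$ times continuously differentiable, $f(0)=0$, $B$ is an unknown polynomial matrix, and bounds $|\partial^{k+1}f_i(x)/\partial x^{\rho}|\le M_{i,\rho}$ are known for all $x\in\mathbb R^{n_x}$, all $i$ and all multi-indices $|\rho|=k+1$. Let $T_k[f_i]$ be the Taylor polynomial of order $k$ of $f_i$ at $0$ and $R_k[f_i]=f_i-T_k[f_i]$. It is known that $T_k[f_i](x)=a_i^Tz_i(x)$ and that the $i$-th row of $B(x)$ is $b_i^TG_i(x)$, where $z_i(x)$ is a vector of (all or some of the) polynomials $x^\alpha/\alpha!$, $1\le|\alpha|\le k$, $G_i$ is a known polynomial matrix, and $[a_i^T\ b_i^T]^T=S_i\Theta$ with known matrices $S_i$ and an unknown vector $\Theta\in\mathbb R^{n_\Theta}$. The remainder $R_k[f]$ is a fixed deterministic (unknown) function. Let $Z(x,u)$ be the matrix with rows $\begin{bmatrix}z_i(x)\\G_i(x)u\end{bmatrix}^TS_i$, so that $f(x)+B(x)u=Z(x,u)\Theta+R_k[f](x)$.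 **Data and posterior.** Samples $\dot{\tilde x}_s=Z(\tilde x_s,\tilde u_s)\Theta+R_k[f](\tilde x_s)+\tilde d_s$, $s=1,\dots,S$, are given, with independent $\tilde d_s\sim\mathcal N(0,\sigma^2I)$, $\sigma>0$ known, and $\sum_sZ(\tilde x_s,\tilde u_s)^TZ(\tilde x_s,\tilde u_s)\succ0$. The coefficients $\Theta$ have the uniform (improper) prior $p(\Theta)\propto1$; their posterior distribution given the samples has the density proportional to the likelihood. Put $\Sigma_\Theta^{-1}=\sigma^{-2}\sum_sZ(\tilde x_s,\tilde u_s)^TZ(\tilde x_s,\tilde u_s)$, $\mu_{\Theta1}=\sigma^{-2}\Sigma_\Theta\sum_sZ(\tilde x_s,\tilde u_s)^T\dot{\tilde x}_s$, let $Q_{n_\Theta}(\delta)$ be the quantile of level $\delta\in(0,1)$ of the chi-squared distribution with $n_\Theta$ degrees of freedom, and let $$\ell=\frac{2}{\sigma^2}\sum_s\big|\Sigma_\Theta Z(\tilde x_s,\tilde u_s)^T\big|_{\mathrm{ele}}\,r(\tilde x_s),\qquad r_i(x)=\sum_{|\rho|=k+1}\frac{M_{i,\rho}}{\rho!}|x^\rho|,$$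 where $|\cdot|_{\mathrm{ele}}$ is the elementwise absolute value and every zero entry of $\ell$ is replaced by an arbitrary positive number. **Set-membership.** Let $\Delta_1\succ0$, $\Delta_2\in\mathbb R^{n_\Theta}$, $\eta_0,\dots,\eta_{n_\Theta}\ge0$ satisfy, with $\Delta_3=\Delta_2^T\Delta_1^{-1}\Delta_2-1$ and $W=\mathrm{diag}(\eta_1/(\ell_1/2)^2,\dots,\eta_{n_\Theta}/(\ell_{n_\Theta}/2)^2)$, $$-\begin{bmatrix}\Delta_1&0&\Delta_2\\0&0&0\\\Delta_2^T&0&\Delta_3\end{bmatrix}+\begin{bmatrix}0&0&0\\0&W&-W\mu_{\Theta1}\\0&-(W\mu_{\Theta1})^T&\mu_{\Theta1}^TW\mu_{\Theta1}-\sum_{i\ge1}\eta_i\end{bmatrix}+\eta_0\begin{bmatrix}\Sigma_\Theta^{-1}&-\Sigma_\Theta^{-1}&0\\-\Sigma_\Theta^{-1}&\Sigma_\Theta^{-1}&0\\0&0&-Q_{n_\Theta}(\delta)\end{bmatrix}\succeq0.$$ **Synthesis condition.** Let $\kappa_i$ be the number of $\rho$ with $|\rho|=k+1$ and $M_{i,\rho}\ne0$,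 let $\mathcal D$ be the diagonal matrix with the entries $\sum_i\kappa_iM_{i,\rho}^2$, $|\rho|=k+1$, and $\omega(x)$ the vector with the entries $x^\rho/\rho!$, where the indices $\rho$ with zero entry in $\mathcal D$ are omitted from both. Let $z(x)\in\mathbb R^{n_z}$ be a vector of monomials with $z(0)=0$ whose first $n_x$ entries are those of $x$, and let $F_i(x)$, $\Omega(x)$ be polynomial matrices with $z_i=F_iz$ and $\omega=\Omega z$. For $P\in\mathbb R^{n_z\times n_z}$, a polynomial matrix $K(x)$ and polynomials $\tau_0,\dots,\tau_{n_x}$, put $\mathcal T=\mathrm{diag}(\tau_1,\dots,\tau_{n_x})$, $L=\left[\begin{bmatrix}F_1P\\G_1K\end{bmatrix}^TS_1\ \cdots\ \begin{bmatrix}F_{n_x}P\\G_{n_x}K\end{bmatrix}^TS_{n_x}\right]$ and $\Psi(x)=Y(x)^T\Pi(x)Y(x)$ with $$\Pi=\mathrm{diag}\left(\begin{bmatrix}0&I\\I&0\end{bmatrix},\begin{bmatrix}-\tau_0I&0\\0&\tau_0\mathcal D^{-1}\end{bmatrix},\begin{bmatrix}\mathcal T\otimes\Delta_3&-(\mathcal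 T\otimes\Delta_2)^T\\-\mathcal T\otimes\Delta_2&\mathcal T\otimes\Delta_1\end{bmatrix}\right),\qquad Y=\begin{bmatrix}0&-P\Omega^T&-L\\I&0&0\\-\frac{\partial z}{\partial x}^T&0&0\\0&I&0\\-\frac{\partial z}{\partial x}^T&0&0\\0&0&I\end{bmatrix}.$$ A polynomial matrix is called SOS if it equals $Q^TQ$ for a polynomial matrix $Q$; an SOS polynomial is a $1\times1$ SOS matrix. **Theorem.** If $P\succ0$, $K(x)$ and $\tau_0,\dots,\tau_{n_x}$ are such that $\tau_i-\epsilon_\tau$ is SOS for $i=0,\dots,n_x$ and some $\epsilon_\tau>0$, and $\Psi(x)-\epsilon I$ is an SOS matrix for some $\epsilon>0$, then the posterior distribution of $\Theta$ is a probability distribution, and with posterior probability at least $\delta$ the equilibrium $x=0$ of $\dot x=f(x)+B(x)u$ is globally asymptotically stable under the state feedback $u(x)=K(x)P^{-1}z(x)$. -/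

import Mathlib

open Matrix MeasureTheory ProbabilityTheory Filter Topology
open scoped Kronecker Nat ENNReal NNReal

noncomputable section

namespace TaylorSynthesis

/-! ### Polynomials and sums of squares -/

/-- The ring `ℝ[x]` of real polynomials in `x = (x_1, …, x_n)`. -/
abbrev Poly (n : ℕ) : Type := MvPolynomial (Fin n) ℝ

/-- A quadratic polynomial matrix `A` is an SOS matrix if `A = Qᵀ Q` for a polynomial matrix `Q`
with any number of rows. -/
def IsSOSMatrix {n : ℕ} {ι : Type*} (A : Matrix ι ι (Poly n)) : Prop :=
  ∃ (r : ℕ) (Q : Matrix (Fin r) ι (Poly n)), A = Qᵀ * Q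

/-- SOS polynomials are the `1 × 1` SOS matrices. -/
def IsSOS {n : ℕ} (p : Poly n) : Prop :=
  IsSOSMatrix (Matrix.of fun (_ _ : Unit) => p)

/-- A real matrix as a constant polynomial matrix. -/
def constMat {n : ℕ} {ι κ : Type*} (A : Matrix ι κ ℝ) : Matrix ι κ (Poly n) :=
  A.map MvPolynomial.C

/-- Pointwise evaluation of a polynomial matrix. -/
def evalMat {n : ℕ} {ι κ : Type*} (A : Matrix ι κ (Poly n)) (x : Fin n → ℝ) : Matrix ι κ ℝ :=
  A.map (MvPolynomial.eval x)

/-- Pointwise evaluation of a polynomial vector. -/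
def evalVec {n : ℕ} {ι : Type*} (v : ι → Poly n) (x : Fin n → ℝ) : ι → ℝ :=
  fun a => MvPolynomial.eval x (v a)

/-! ### Multi-indices, partial derivatives and Taylor polynomials -/

/-- `α! = α_1! ⋯ α_n!`. -/
def multiFactorial {n : ℕ} (α : Fin n → ℕ) : ℕ := ∏ j, (α j)!

/-- The monomial `x^α`. -/
def monom {n : ℕ} (α : Fin n → ℕ) : Poly n := ∏ j, MvPolynomial.X j ^ α j

/-- The polynomial `x^α / α!`. -/
def scaledMonom {n : ℕ} (α : Fin n → ℕ) : Poly n :=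
  MvPolynomial.C ((multiFactorial α : ℝ)⁻¹) * monom α

/-- The finite set of the multi-indices `α` with `|α| = d`. -/
def multiIndices (n d : ℕ) : Finset (Fin n → ℕ) := Finset.piAntidiag Finset.univ d

/-- The partial derivative `∂g/∂x_j`. -/
def partialDeriv {n : ℕ} (j : Fin n) (g : (Fin n → ℝ) → ℝ) : (Fin n → ℝ) → ℝ :=
  fun x => fderiv ℝ g x (Pi.single j 1)

/-- The partial derivative `∂^{|α|} g / ∂x^α = ∂_1^{α_1} ⋯ ∂_n^{α_n} g`. -/
def multiDeriv {n : ℕ} (α : Fin n → ℕ) (g : (Fin n → ℝ) → ℝ) : (Fin n → ℝ) → ℝ :=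
  (List.finRange n).foldr (fun j h => (partialDeriv j)^[α j] h) g

/-- The Taylor polynomial `T_k[g](x) = ∑_{1 ≤ |α| ≤ k} (1/α!) (∂^{|α|}g(0)/∂x^α) x^α` around the
origin of a function with `g 0 = 0`. -/
def taylorPoly {n : ℕ} (k : ℕ) (g : (Fin n → ℝ) → ℝ) (x : Fin n → ℝ) : ℝ :=
  ∑ d ∈ Finset.Icc 1 k, ∑ α ∈ multiIndices n d,
    (multiFactorial α : ℝ)⁻¹ * multiDeriv α g 0 * ∏ j, x j ^ α j

/-- The remainder `R_k[g] = g - T_k[g]`. -/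
def taylorRem {n : ℕ} (k : ℕ) (g : (Fin n → ℝ) → ℝ) (x : Fin n → ℝ) : ℝ :=
  g x - taylorPoly k g x

/-! ### Global asymptotic stability -/

/-- The equilibrium `0` of `ẋ = F(x)` is globally asymptotically stable: solutions exist for all
`t ≥ 0` from every initial state, the origin is Lyapunov stable and attracts every solution.
(The topology of `ℝⁿ` enters only through neighbourhoods, so the choice of norm is irrelevant.) -/
structure GloballyAsymptoticallyStable {n : ℕ} (F : (Fin n → ℝ) → (Fin n → ℝ)) : Prop where
  equilibrium : F 0 = 0
  exists_solution : ∀ x₀ : Fin n → ℝ, ∃ γ : ℝ → (Fin n → ℝ),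
    γ 0 = x₀ ∧ IsIntegralCurveOn γ (fun _ => F) (Set.Ici 0)
  stable : ∀ U ∈ 𝓝 (0 : Fin n → ℝ), ∃ V ∈ 𝓝 (0 : Fin n → ℝ), ∀ γ : ℝ → (Fin n → ℝ),
    IsIntegralCurveOn γ (fun _ => F) (Set.Ici 0) → γ 0 ∈ V → ∀ t ≥ 0, γ t ∈ U
  attractive : ∀ γ : ℝ → (Fin n → ℝ),
    IsIntegralCurveOn γ (fun _ => F) (Set.Ici 0) → Tendsto γ atTop (𝓝 0)

/-! ### Quantiles of the chi-squared distribution -/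

/-- The chi-squared distribution with `d` degrees of freedom: the law of the sum of the squares of
`d` independent standard Gaussian random variables. -/
def chiSquared (d : ℕ) : Measure ℝ :=
  (Measure.pi fun _ : Fin d => gaussianReal 0 1).map fun v => ∑ i, v i ^ 2

/-- The quantile function `Q_d` of the chi-squared distribution, for levels in `(0, 1)`. -/
def chiSquaredQuantile (d : ℕ) (δ : ℝ) : ℝ :=
  sInf {q : ℝ | ENNReal.ofReal δ ≤ chiSquared d (Set.Iic q)}

/-! ### Prior knowledge and data -/

/-- The known structure of an unknown system `ẋ = f(x) + B(x) u` with `n` states, `nu` inputs and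
`nΘ` unknown coefficients. -/
structure Knowledge (n nu nΘ : ℕ) where
  /-- The order of the Taylor polynomials. -/
  k : ℕ
  /-- The multi-indices of the monomials that may occur in the `i`-th Taylor polynomial. -/
  A : Fin n → Finset (Fin n → ℕ)
  /-- These multi-indices satisfy `1 ≤ |α| ≤ k`. -/
  hA : ∀ i, ∀ α ∈ A i, 1 ≤ ∑ j, α j ∧ ∑ j, α j ≤ k
  /-- The number of unknown coefficients of the `i`-th row of `B`. -/
  nb : Fin n → ℕ
  /-- The `i`-th row of `B(x)` is `b_iᵀ G_i(x)`. -/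
  G : ∀ i, Matrix (Fin (nb i)) (Fin nu) (Poly n)
  /-- The coefficients of the `i`-th row are `[a_i; b_i] = S_i Θ`. -/
  S : ∀ i, Matrix (A i ⊕ Fin (nb i)) (Fin nΘ) ℝ
  /-- The bounds `M_{i,ρ}` on the partial derivatives of `f_i` of order `k + 1`. -/
  M : Fin n → (Fin n → ℕ) → ℝ

/-- Samples `(ẋ_s, x_s, u_s)`. -/
structure Samples (n nu N : ℕ) where
  xdot : Fin N → Fin n → ℝ
  x : Fin N → Fin n → ℝ
  u : Fin N → Fin nu → ℝ

namespace Knowledge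

variable {n nu nΘ : ℕ} (𝒦 : Knowledge n nu nΘ)

/-- The vector `z_i(x)` of the polynomials `x^α / α!`. -/
def zRow (i : Fin n) : 𝒦.A i → Poly n := fun α => scaledMonom α.1

/-- The coefficients `a_i` that belong to `Θ`. -/
def aCoef (θ : Fin nΘ → ℝ) (i : Fin n) : 𝒦.A i → ℝ := fun α => (𝒦.S i *ᵥ θ) (Sum.inl α)

/-- The coefficients `b_i` that belong to `Θ`. -/
def bCoef (θ : Fin nΘ → ℝ) (i : Fin n) : Fin (𝒦.nb i) → ℝ := fun l => (𝒦.S i *ᵥ θ) (Sum.inr l)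

/-- `(f, B)` is, for each value `θ` of the unknown coefficients, an input-affine system
`ẋ = f(x) + B(x) u` that complies with the prior knowledge and has the coefficients `θ`; the
Taylor remainder of the drift is the deterministic function `R`. -/
structure IsSystemFamily (f : (Fin nΘ → ℝ) → (Fin n → ℝ) → (Fin n → ℝ))
    (B : (Fin nΘ → ℝ) → Matrix (Fin n) (Fin nu) (Poly n))
    (R : (Fin n → ℝ) → (Fin n → ℝ)) : Prop where
  contDiff : ∀ θ, ContDiff ℝ (𝒦.k + 1) (f θ)
  map_zero : ∀ θ, f θ 0 = 0
  deriv_bound : ∀ θ i, ∀ ρ ∈ multiIndices n (𝒦.k + 1), ∀ x,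
    |multiDeriv ρ (fun y => f θ y i) x| ≤ 𝒦.M i ρ
  taylor : ∀ θ i x, taylorPoly 𝒦.k (fun y => f θ y i) x =
    𝒦.aCoef θ i ⬝ᵥ evalVec (𝒦.zRow i) x
  remainder : ∀ θ i x, taylorRem 𝒦.k (fun y => f θ y i) x = R x i
  input : ∀ θ i j, B θ i j = ∑ l, MvPolynomial.C (𝒦.bCoef θ i l) * 𝒦.G i l j

/-- The regressor matrix `Z(x, u)`, with rows `[z_i(x); G_i(x) u]ᵀ S_i`. -/
def regressor (x : Fin n → ℝ) (u : Fin nu → ℝ) : Matrix (Fin n) (Fin nΘ) ℝ :=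
  Matrix.of fun i => Sum.elim (evalVec (𝒦.zRow i) x) (evalMat (𝒦.G i) x *ᵥ u) ᵥ* 𝒦.S i

/-- The bound `R_k^abs[f_i(x)] = (∑_ρ M_{i,ρ} |x^ρ| / ρ!)²` on the squared remainder. -/
def remAbs (i : Fin n) (x : Fin n → ℝ) : ℝ :=
  (∑ ρ ∈ multiIndices n (𝒦.k + 1),
    𝒦.M i ρ / (multiFactorial ρ : ℝ) * |∏ j, x j ^ ρ j|) ^ 2

/-- `κ_i` is the number of nonzero bounds `M_{i,ρ}`. -/
def kappa (i : Fin n) : ℕ := ((multiIndices n (𝒦.k + 1)).filter fun ρ => 𝒦.M i ρ ≠ 0).card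

/-- The diagonal entries `∑_i κ_i M_{i,ρ}²` of the matrix `𝒟` of the remainder bound. -/
def dDiag (ρ : Fin n → ℕ) : ℝ := ∑ i, (𝒦.kappa i : ℝ) * 𝒦.M i ρ ^ 2

/-- The multi-indices `ρ` with `|ρ| = k + 1` and a nonzero entry in `𝒟`; the other entries are
omitted from `𝒟` and `ω`. -/
def remIndices : Finset (Fin n → ℕ) :=
  (multiIndices n (𝒦.k + 1)).filter fun ρ => 𝒦.dDiag ρ ≠ 0

/-- The matrix `𝒟`. -/
def D : Matrix 𝒦.remIndices 𝒦.remIndices ℝ := Matrix.diagonal fun ρ => 𝒦.dDiag ρ.1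

/-- The vector `ω(x)` of the polynomials `x^ρ / ρ!`. -/
def omegaVec : 𝒦.remIndices → Poly n := fun ρ => scaledMonom ρ.1

/-! ### Bayesian inference -/

variable {N : ℕ} (data : Samples n nu N)

/-- The likelihood `p(ẋ_1, …, ẋ_N | Θ = θ)` of the samples
`ẋ_s = Z(x_s, u_s) θ + R(x_s) + d_s` with independent disturbances `d_s ∼ 𝒩(0, σ² I)`. -/
def likelihood (σ : ℝ) (R : (Fin n → ℝ) → (Fin n → ℝ)) (θ : Fin nΘ → ℝ) : ℝ≥0∞ :=
  ∏ s, ∏ i, gaussianPDF ((𝒦.regressor (data.x s) (data.u s) *ᵥ θ) i + R (data.x s) i)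
    (Real.toNNReal (σ ^ 2)) (data.xdot s i)

/-- The posterior distribution of the coefficients given the samples, by Bayes' rule for the
uniform prior `p(Θ) ∝ 1`: the normalized measure whose density is the likelihood. -/
def posterior (σ : ℝ) (R : (Fin n → ℝ) → (Fin n → ℝ)) : Measure (Fin nΘ → ℝ) :=
  (∫⁻ θ, 𝒦.likelihood data σ R θ)⁻¹ • volume.withDensity (𝒦.likelihood data σ R)

/-- `∑_s Z(x_s, u_s)ᵀ Z(x_s, u_s)`. -/
def gram : Matrix (Fin nΘ) (Fin nΘ) ℝ :=
  ∑ s, (𝒦.regressor (data.x s) (data.u s))ᵀ * 𝒦.regressor (data.x s) (data.u s)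

/-- `Σ_Θ⁻¹ = σ⁻² ∑_s Z(x_s, u_s)ᵀ Z(x_s, u_s)`. -/
def precision (σ : ℝ) : Matrix (Fin nΘ) (Fin nΘ) ℝ := (σ ^ 2)⁻¹ • 𝒦.gram data

/-- The known centre `μ_{Θ1} = σ⁻² Σ_Θ ∑_s Z(x_s, u_s)ᵀ ẋ_s`. -/
def muOne (σ : ℝ) : Fin nΘ → ℝ :=
  (σ ^ 2)⁻¹ • ((𝒦.precision data σ)⁻¹ *ᵥ
    ∑ s, (𝒦.regressor (data.x s) (data.u s))ᵀ *ᵥ data.xdot s)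

/-- The edge lengths
`(2/σ²) ∑_s |Σ_Θ Z(x_s, u_s)ᵀ|_ele [√R_k^abs[f_1(x_s)]; …; √R_k^abs[f_n(x_s)]]`. -/
def edgeLength (σ : ℝ) (m : Fin nΘ) : ℝ :=
  2 / σ ^ 2 * ∑ s, ∑ i,
    |((𝒦.precision data σ)⁻¹ * (𝒦.regressor (data.x s) (data.u s))ᵀ) m i| *
      √(𝒦.remAbs i (data.x s))

end Knowledge

/-! ### The ellipsoidal outer approximation -/

/-- `Δ₃ = Δ₂ᵀ Δ₁⁻¹ Δ₂ - 1`. -/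
def deltaThree {nΘ : ℕ} (Δ₁ : Matrix (Fin nΘ) (Fin nΘ) ℝ) (Δ₂ : Fin nΘ → ℝ) : ℝ :=
  Δ₂ ⬝ᵥ (Δ₁⁻¹ *ᵥ Δ₂) - 1

/-- `W = diag(η_1 / (ℓ_1/2)² | ⋯ | η_{nΘ} / (ℓ_{nΘ}/2)²)`. -/
def weightW {nΘ : ℕ} (ℓ η : Fin nΘ → ℝ) : Matrix (Fin nΘ) (Fin nΘ) ℝ :=
  Matrix.diagonal fun m => η m / (ℓ m / 2) ^ 2

/-- The symmetric block matrix `[A, B, b; Bᵀ, C, c; bᵀ, cᵀ, d]`. -/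
def symBlock {nΘ : ℕ} (A B C : Matrix (Fin nΘ) (Fin nΘ) ℝ) (b c : Fin nΘ → ℝ) (d : ℝ) :
    Matrix ((Fin nΘ ⊕ Fin nΘ) ⊕ Unit) ((Fin nΘ ⊕ Fin nΘ) ⊕ Unit) ℝ :=
  Matrix.fromBlocks (Matrix.fromBlocks A B Bᵀ C)
    (Matrix.replicateCol Unit (Sum.elim b c)) (Matrix.replicateRow Unit (Sum.elim b c))
    (Matrix.of fun _ _ => d)

/-- The left-hand side of the linear matrix inequality for the outer ellipsoid
`{Θ | [Θ; 1]ᵀ [Δ₁, Δ₂; Δ₂ᵀ, Δ₃] [Θ; 1] ≤ 0}` of the sum of the ellipsoid `Θᵀ Λ Θ ≤ q` and the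
hyperrectangle with centre `μ₁` and edge lengths `ℓ`. -/
def outerLMI {nΘ : ℕ} (Λ : Matrix (Fin nΘ) (Fin nΘ) ℝ) (q : ℝ) (μ₁ ℓ : Fin nΘ → ℝ)
    (Δ₁ : Matrix (Fin nΘ) (Fin nΘ) ℝ) (Δ₂ : Fin nΘ → ℝ) (η₀ : ℝ) (η : Fin nΘ → ℝ) :
    Matrix ((Fin nΘ ⊕ Fin nΘ) ⊕ Unit) ((Fin nΘ ⊕ Fin nΘ) ⊕ Unit) ℝ :=
  -symBlock Δ₁ 0 0 Δ₂ 0 (deltaThree Δ₁ Δ₂)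
    + symBlock 0 0 (weightW ℓ η) 0 (-(weightW ℓ η *ᵥ μ₁))
        (μ₁ ⬝ᵥ (weightW ℓ η *ᵥ μ₁) - ∑ m, η m)
    + η₀ • symBlock Λ (-Λ) Λ 0 0 (-q)

/-! ### The synthesis condition -/

/-- The vector of monomials `z(x) = [x; x^{β_1}; …; x^{β_m}]`, so that `x = [I 0] z(x)`. -/
def zVec {n m : ℕ} (β : Fin m → (Fin n → ℕ)) : Fin n ⊕ Fin m → Poly n :=
  Sum.elim MvPolynomial.X fun l => monom (β l)

/-- The Jacobian matrix `∂z/∂x`. -/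
def jacobian {n : ℕ} {ι : Type*} (z : ι → Poly n) : Matrix ι (Fin n) (Poly n) :=
  Matrix.of fun a j => MvPolynomial.pderiv j (z a)

/-- `T ⊗ v` for a column vector `v`. -/
def kronCol {n : ℕ} {ι : Type*} (T : Matrix (Fin n) (Fin n) (Poly n)) (v : ι → ℝ) :
    Matrix (Fin n × ι) (Fin n) (Poly n) :=
  (T ⊗ₖ constMat (n := n) (Matrix.replicateCol Unit v)).submatrix id fun i => (i, ())

namespace Knowledge

variable {n nu nΘ m : ℕ} (𝒦 : Knowledge n nu nΘ)

/-- The row of matrices `[[F_1 P; G_1 K]ᵀ S_1 ⋯ [F_n P; G_n K]ᵀ S_n]`. -/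
def gainRow (F : ∀ i, Matrix (𝒦.A i) (Fin n ⊕ Fin m) (Poly n))
    (P : Matrix (Fin n ⊕ Fin m) (Fin n ⊕ Fin m) ℝ)
    (K : Matrix (Fin nu) (Fin n ⊕ Fin m) (Poly n)) :
    Matrix (Fin n ⊕ Fin m) (Fin n × Fin nΘ) (Poly n) :=
  Matrix.of fun a p =>
    (Matrix.transpose (Matrix.fromRows (F p.1 * constMat (n := n) P) (𝒦.G p.1 * K)) *
      constMat (n := n) (𝒦.S p.1) : Matrix (Fin n ⊕ Fin m) (Fin nΘ) (Poly n)) a p.2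

/-- The inner block-diagonal matrix of `Ψ(x)`. -/
def innerMat (τ₀ : Poly n) (τ : Fin n → Poly n)
    (Δ₁ : Matrix (Fin nΘ) (Fin nΘ) ℝ) (Δ₂ : Fin nΘ → ℝ) :
    Matrix
      (((Fin n ⊕ Fin m) ⊕ (Fin n ⊕ Fin m)) ⊕ ((Fin n ⊕ 𝒦.remIndices) ⊕ (Fin n ⊕ Fin n × Fin nΘ)))
      (((Fin n ⊕ Fin m) ⊕ (Fin n ⊕ Fin m)) ⊕ ((Fin n ⊕ 𝒦.remIndices) ⊕ (Fin n ⊕ Fin n × Fin nΘ)))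
      (Poly n) :=
  Matrix.fromBlocks
    (Matrix.fromBlocks 0 1 1 0) 0
    0 (Matrix.fromBlocks
      (Matrix.fromBlocks (-(τ₀ • (1 : Matrix (Fin n) (Fin n) (Poly n)))) 0
        0 (τ₀ • constMat (n := n) (𝒦.D)⁻¹)) 0
      0 (Matrix.fromBlocks
        (deltaThree Δ₁ Δ₂ • Matrix.diagonal τ) (-(kronCol (Matrix.diagonal τ) Δ₂)ᵀ)
        (-kronCol (Matrix.diagonal τ) Δ₂) (Matrix.diagonal τ ⊗ₖ constMat (n := n) Δ₁)))

/-- The outer factor of `Ψ(x)`, with block columns of widths `n_z`, `dim ω` and `n · nΘ`. -/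
def outerMat (β : Fin m → (Fin n → ℕ))
    (F : ∀ i, Matrix (𝒦.A i) (Fin n ⊕ Fin m) (Poly n))
    (Ω : Matrix 𝒦.remIndices (Fin n ⊕ Fin m) (Poly n))
    (P : Matrix (Fin n ⊕ Fin m) (Fin n ⊕ Fin m) ℝ)
    (K : Matrix (Fin nu) (Fin n ⊕ Fin m) (Poly n)) :
    Matrix
      (((Fin n ⊕ Fin m) ⊕ (Fin n ⊕ Fin m)) ⊕ ((Fin n ⊕ 𝒦.remIndices) ⊕ (Fin n ⊕ Fin n × Fin nΘ)))
      ((Fin n ⊕ Fin m) ⊕ (𝒦.remIndices ⊕ Fin n × Fin nΘ)) (Poly n) :=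
  Matrix.fromRows
    (Matrix.fromRows
      (Matrix.fromCols 0 (Matrix.fromCols (-(constMat (n := n) P * Ωᵀ)) (-(𝒦.gainRow F P K))))
      (Matrix.fromCols 1 (Matrix.fromCols 0 0)))
    (Matrix.fromRows
      (Matrix.fromRows
        (Matrix.fromCols (-(jacobian (zVec β))ᵀ) (Matrix.fromCols 0 0))
        (Matrix.fromCols 0 (Matrix.fromCols 1 0)))
      (Matrix.fromRows
        (Matrix.fromCols (-(jacobian (zVec β))ᵀ) (Matrix.fromCols 0 0))
        (Matrix.fromCols 0 (Matrix.fromCols 0 1))))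

/-- The polynomial matrix `Ψ(x)` of the synthesis condition. -/
def Psi (β : Fin m → (Fin n → ℕ))
    (F : ∀ i, Matrix (𝒦.A i) (Fin n ⊕ Fin m) (Poly n))
    (Ω : Matrix 𝒦.remIndices (Fin n ⊕ Fin m) (Poly n))
    (Δ₁ : Matrix (Fin nΘ) (Fin nΘ) ℝ) (Δ₂ : Fin nΘ → ℝ)
    (P : Matrix (Fin n ⊕ Fin m) (Fin n ⊕ Fin m) ℝ)
    (K : Matrix (Fin nu) (Fin n ⊕ Fin m) (Poly n))
    (τ₀ : Poly n) (τ : Fin n → Poly n) :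
    Matrix ((Fin n ⊕ Fin m) ⊕ (𝒦.remIndices ⊕ Fin n × Fin nΘ))
      ((Fin n ⊕ Fin m) ⊕ (𝒦.remIndices ⊕ Fin n × Fin nΘ)) (Poly n) :=
  Matrix.transpose (𝒦.outerMat β F Ω P K) * 𝒦.innerMat (m := m) τ₀ τ Δ₁ Δ₂ * 𝒦.outerMat β F Ω P K

end Knowledge

/-- The state feedback `u(x) = K(x) P⁻¹ z(x)`. -/
def feedback {n nu m : ℕ} (β : Fin m → (Fin n → ℕ))
    (P : Matrix (Fin n ⊕ Fin m) (Fin n ⊕ Fin m) ℝ)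
    (K : Matrix (Fin nu) (Fin n ⊕ Fin m) (Poly n)) (x : Fin n → ℝ) : Fin nu → ℝ :=
  evalMat K x *ᵥ (P⁻¹ *ᵥ evalVec (zVec β) x)

/-- The closed loop `ẋ = f(x) + B(x) u(x)`. -/
def closedLoop {n nu : ℕ} (f : (Fin n → ℝ) → (Fin n → ℝ)) (B : Matrix (Fin n) (Fin nu) (Poly n))
    (u : (Fin n → ℝ) → (Fin nu → ℝ)) (x : Fin n → ℝ) : Fin n → ℝ :=
  f x + evalMat B x *ᵥ u x

end TaylorSynthesis

end

namespace TaylorSynthesis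

/-! ### Taylor's theorem in several variables -/

section Taylor

variable {n : ℕ}

/-! The argument has a probabilistic and a deterministic half, joined by an ellipsoid of
coefficients. Probabilistic half: completing the square shows that the likelihood is an unnormalized
Gaussian density in `θ` with covariance `Σ_Θ`, centred at the least-squares estimate `μ` of the data
corrected by `R(x_s)` (`Knowledge.likelihood_eq`). Whitening turns `(θ - μ)ᵀ Σ_Θ⁻¹ (θ - μ)` into a
chi-squared variable, so the ellipsoid cut off at the quantile carries mass at least `δ`
(`Knowledge.posterior_ellipsoid`). Its centre is unknown because `R` is, but `μ - μ_{Θ1}` is linear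
in the remainders, which Taylor's theorem bounds (`abs_taylorRem_le`); hence `μ` lies in the
hyperrectangle with edges `ℓ` (`Knowledge.abs_posteriorMean_sub_le`). By the S-procedure, the linear
matrix inequality places the ellipsoid around every such centre inside the outer ellipsoid given by
`Δ₁`, `Δ₂` (`mem_outerEllipsoid`). Deterministic half: for `θ` in the outer ellipsoid, `V = zᵀ P⁻¹
z` is a Lyapunov function. With `y = P⁻¹ z` and `r = -(∂z/∂x)ᵀ y`, the form of `Ψ` is tested on `(y,
v, w)`, where `w = -(r ⊗ θ)` produces the term of the parametric dynamics and `v` is chosen so that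
`ωᵀ v = -rᵀ R`. The leading block then equals `-V̇`, and the two multiplier blocks are nonpositive:
one by the remainder bound, the other because `θ` lies in the outer ellipsoid. What is left is `V̇ ≤
-ε |y|²` (`dissipation`). Comparing `|y|²` with `V` gives exponential decay of `V`, and Lyapunov's
direct method concludes (`globallyAsymptoticallyStable_of_lyapunov`). -/

lemma contDiff_partialDeriv {r : ℕ} {g : (Fin n → ℝ) → ℝ} (j : Fin n)
    (hg : ContDiff ℝ (r + 1 : ℕ) g) : ContDiff ℝ r (partialDeriv j g) :=
  (hg.fderiv_right (m := (r : WithTop ℕ∞)) (by norm_cast)).clm_apply contDiff_const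

lemma contDiff_iterate_partialDeriv {r : ℕ} (j : Fin n) (a : ℕ) :
    ∀ {g : (Fin n → ℝ) → ℝ}, ContDiff ℝ (a + r : ℕ) g →
      ContDiff ℝ r ((partialDeriv j)^[a] g) := by
  induction a with
  | zero => intro g hg; simpa using hg
  | succ a ih =>
    intro g hg
    rw [Function.iterate_succ_apply]
    exact ih (contDiff_partialDeriv j (by convert hg using 2; ring_nf))

lemma partialDeriv_comm {g : (Fin n → ℝ) → ℝ} (hg : ContDiff ℝ 2 g) (i j : Fin n) :
    partialDeriv i (partialDeriv j g) = partialDeriv j (partialDeriv i g) := by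
  have hd : Differentiable ℝ (fderiv ℝ g) :=
    (hg.fderiv_right (m := 1) (by norm_num)).differentiable (by norm_num)
  have key : ∀ (i j : Fin n) x, partialDeriv i (partialDeriv j g) x =
      fderiv ℝ (fderiv ℝ g) x (Pi.single i 1) (Pi.single j 1) := by
    intro i j x
    unfold partialDeriv
    rw [fderiv_clm_apply (hd x) (by fun_prop)]
    simp
  ext x
  rw [key, key]
  exact (hg.contDiffAt.isSymmSndFDerivAt (by simp)).eq _ _

lemma partialDeriv_iterate_comm (i j : Fin n) (a : ℕ) :
    ∀ {g : (Fin n → ℝ) → ℝ}, ContDiff ℝ (a + 1 : ℕ) g →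
      partialDeriv j ((partialDeriv i)^[a] g) = (partialDeriv i)^[a] (partialDeriv j g) := by
  induction a with
  | zero => intro g _; rfl
  | succ a ih =>
    intro g hg
    rw [Function.iterate_succ_apply, Function.iterate_succ_apply,
      ih (contDiff_partialDeriv i hg),
      partialDeriv_comm (hg.of_le (by norm_cast; omega)) j i]

lemma contDiff_foldr_partialDeriv (l : List (Fin n)) (α : Fin n → ℕ) {g : (Fin n → ℝ) → ℝ} :
    ∀ {r : ℕ}, ContDiff ℝ ((l.map α).sum + r : ℕ) g →
      ContDiff ℝ r (l.foldr (fun j h => (partialDeriv j)^[α j] h) g) := by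
  induction l with
  | nil => intro r hg; simpa using hg
  | cons i l ih =>
    intro r hg
    rw [List.foldr_cons]
    apply contDiff_iterate_partialDeriv
    apply ih
    convert hg using 2
    simp only [List.map_cons, List.sum_cons]
    ring

/-- Iterated derivatives are taken in a fixed order, so the extra `∂_j` is commuted inward, by
symmetry of second derivatives, until it meets its own block. Without repetitions in `l` there is
only one such block. The additional order of smoothness is what permits the commutations. -/
lemma partialDeriv_foldr (l : List (Fin n)) (hl : l.Nodup) (α : Fin n → ℕ) {j : Fin n}
    (hj : j ∈ l) {g : (Fin n → ℝ) → ℝ} (hg : ContDiff ℝ ((l.map α).sum + 1 : ℕ) g) :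
    partialDeriv j (l.foldr (fun j h => (partialDeriv j)^[α j] h) g) =
      l.foldr (fun i h => (partialDeriv i)^[(α + Pi.single j 1 : Fin n → ℕ) i] h) g := by
  induction l with
  | nil => simp at hj
  | cons i l ih =>
    rw [List.nodup_cons] at hl
    rw [List.foldr_cons, List.foldr_cons]
    by_cases hij : i = j
    · subst hij
      have : l.foldr (fun j h => (partialDeriv j)^[(α + Pi.single i 1 : Fin n → ℕ) j] h) g =
          l.foldr (fun j h => (partialDeriv j)^[α j] h) g := by
        refine List.foldr_ext _ _ _ fun a ha b => ?_
        have : a ≠ i := fun h => hl.1 (h ▸ ha)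
        simp [this]
      rw [this, ← Function.iterate_succ_apply' (partialDeriv i)]
      simp
    · have hjl : j ∈ l := by
        rcases List.mem_cons.1 hj with h | h
        · exact absurd h.symm hij
        · exact h
      rw [partialDeriv_iterate_comm, ih hl.2 hjl (hg.of_le ?_)]
      · simp [hij]
      · norm_cast
        simp only [List.map_cons, List.sum_cons]
        omega
      · apply contDiff_foldr_partialDeriv
        convert hg using 2
        simp only [List.map_cons, List.sum_cons]
        ring

lemma sum_map_finRange (α : Fin n → ℕ) : ((List.finRange n).map α).sum = ∑ j, α j := by
  rw [Fin.sum_univ_def]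

lemma contDiff_multiDeriv {r : ℕ} (α : Fin n → ℕ) {g : (Fin n → ℝ) → ℝ}
    (hg : ContDiff ℝ (∑ j, α j + r : ℕ) g) : ContDiff ℝ r (multiDeriv α g) :=
  contDiff_foldr_partialDeriv _ _ (by rwa [sum_map_finRange])

lemma partialDeriv_multiDeriv (α : Fin n → ℕ) (j : Fin n) {g : (Fin n → ℝ) → ℝ}
    (hg : ContDiff ℝ (∑ j, α j + 1 : ℕ) g) :
    partialDeriv j (multiDeriv α g) = multiDeriv (α + Pi.single j 1) g :=
  partialDeriv_foldr _ (List.nodup_finRange n) α (List.mem_finRange j)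
    (by rwa [sum_map_finRange])

lemma mem_multiIndices {d : ℕ} {α : Fin n → ℕ} : α ∈ multiIndices n d ↔ ∑ j, α j = d := by
  simp [multiIndices]

lemma multiFactorial_pos (α : Fin n → ℕ) : 0 < multiFactorial α :=
  Finset.prod_pos fun _ _ => Nat.factorial_pos _

lemma multiFactorial_add_single (α : Fin n → ℕ) (j : Fin n) :
    multiFactorial (α + Pi.single j 1) = (α j + 1) * multiFactorial α := by
  unfold multiFactorial
  rw [← Finset.mul_prod_erase _ _ (Finset.mem_univ j),
    ← Finset.mul_prod_erase _ (fun i => (α i)!) (Finset.mem_univ j), ← mul_assoc]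
  congr 1
  · simp [Nat.factorial_succ]
  · refine Finset.prod_congr rfl fun i hi => ?_
    simp [Finset.ne_of_mem_erase hi]

/-- Pascal's rule for multinomial coefficients: `ρ` arises from `α = ρ - e_j` with weight `d! ρ_j /
ρ!`, and these weights add up to `(d+1)! / ρ!` since `∑ ρ_j = d + 1`. -/
lemma sum_multiIndices_succ (d : ℕ) (H : (Fin n → ℕ) → ℝ) :
    ∑ α ∈ multiIndices n d, ∑ j, (d ! : ℝ) / multiFactorial α * H (α + Pi.single j 1) =
      ∑ ρ ∈ multiIndices n (d + 1), ((d + 1)! : ℝ) / multiFactorial ρ * H ρ := by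
  have hr : ∀ ρ ∈ multiIndices n (d + 1), ((d + 1)! : ℝ) / multiFactorial ρ * H ρ =
      ∑ j, (d ! : ℝ) * ρ j / multiFactorial ρ * H ρ := by
    intro ρ hρ
    rw [mem_multiIndices] at hρ
    rw [← Finset.sum_mul, ← Finset.sum_div, ← Finset.mul_sum, ← Nat.cast_sum, hρ,
      Nat.factorial_succ]
    push_cast
    ring
  rw [Finset.sum_congr rfl hr, Finset.sum_comm, Finset.sum_comm (s := multiIndices n (d + 1))]
  refine Finset.sum_congr rfl fun j _ => ?_
  -- Terms with `ρ_j = 0` vanish; dropping them makes `α ↦ α + e_j` a bijection despite truncated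
  -- subtraction.
  have hf : ∑ ρ ∈ multiIndices n (d + 1), (d ! : ℝ) * ρ j / multiFactorial ρ * H ρ =
      ∑ ρ ∈ (multiIndices n (d + 1)).filter (fun ρ => ρ j ≠ 0),
        (d ! : ℝ) * ρ j / multiFactorial ρ * H ρ := by
    symm
    apply Finset.sum_filter_of_ne
    intro ρ _ h h0
    simp [h0] at h
  rw [hf]
  refine Finset.sum_bij' (fun α _ => α + Pi.single j 1) (fun ρ _ => ρ - Pi.single j 1) ?_ ?_ ?_ ?_ ?_
  · intro α hα
    rw [mem_multiIndices] at hα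
    simp [mem_multiIndices, Finset.sum_add_distrib, hα]
  · intro ρ hρ
    rw [Finset.mem_filter, mem_multiIndices] at hρ
    rw [mem_multiIndices]
    have h1 : ∑ i, (ρ i - (Pi.single j 1 : Fin n → ℕ) i) + ∑ i, (Pi.single j 1 : Fin n → ℕ) i
        = ∑ i, ρ i := by
      rw [← Finset.sum_add_distrib]
      refine Finset.sum_congr rfl fun i _ => Nat.sub_add_cancel ?_
      by_cases h : i = j
      · subst h; simpa using Nat.one_le_iff_ne_zero.2 hρ.2
      · simp [h]
    simp only [Finset.sum_pi_single', Finset.mem_univ, if_true, hρ.1] at h1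
    simpa using h1
  · intro α _
    ext i; simp
  · intro ρ hρ
    rw [Finset.mem_filter] at hρ
    ext i
    by_cases h : i = j
    · subst h; simpa using Nat.sub_add_cancel (Nat.one_le_iff_ne_zero.2 hρ.2)
    · simp [h]
  · intro α _
    have h1 : (multiFactorial α : ℝ) ≠ 0 := by exact_mod_cast (multiFactorial_pos α).ne'
    have h2 : ((α j : ℝ) + 1) ≠ 0 := by positivity
    rw [multiFactorial_add_single]
    simp only [Pi.add_apply, Pi.single_eq_same]
    push_cast
    field_simp

lemma fderiv_eq_sum_partialDeriv (g : (Fin n → ℝ) → ℝ) (y v : Fin n → ℝ) :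
    fderiv ℝ g y v = ∑ j, v j * partialDeriv j g y := by
  conv_lhs => rw [pi_eq_sum_univ' v]
  simp only [map_sum, map_smul, smul_eq_mul, partialDeriv]

lemma prod_pow_add_single (x : Fin n → ℝ) (α : Fin n → ℕ) (j : Fin n) :
    ∏ i, x i ^ (α + Pi.single j 1 : Fin n → ℕ) i = x j * ∏ i, x i ^ α i := by
  simp only [Pi.add_apply, pow_add, Finset.prod_mul_distrib]
  rw [mul_comm]
  congr 1
  rw [Finset.prod_eq_single j]
  · simp
  · intro i _ h; simp [h]
  · simp

/-- Reduces the multivariate Taylor formula to one variable, along the ray through `x`. The chain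
rule raises one index of each `α`, and `sum_multiIndices_succ` collects the results. -/
lemma iteratedDeriv_comp_smul {N : ℕ} {g : (Fin n → ℝ) → ℝ} (hg : ContDiff ℝ N g)
    (x : Fin n → ℝ) (d : ℕ) (hd : d ≤ N) :
    iteratedDeriv d (fun t : ℝ => g (t • x)) = fun t => ∑ α ∈ multiIndices n d,
      (d ! : ℝ) / multiFactorial α * (multiDeriv α g (t • x) * ∏ j, x j ^ α j) := by
  induction d with
  | zero =>
    have : multiIndices n 0 = {0} := by
      ext α
      simp [mem_multiIndices, funext_iff]
    ext t
    simp [this, multiFactorial, multiDeriv]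
  | succ d ih =>
    rw [iteratedDeriv_succ, ih (by omega)]
    ext t
    rw [← sum_multiIndices_succ d (fun ρ => multiDeriv ρ g (t • x) * ∏ j, x j ^ ρ j)]
    have hder : ∀ α ∈ multiIndices n d, HasDerivAt
        (fun t : ℝ => (d ! : ℝ) / multiFactorial α * (multiDeriv α g (t • x) * ∏ j, x j ^ α j))
        (∑ j, (d ! : ℝ) / multiFactorial α *
          (multiDeriv (α + Pi.single j 1) g (t • x) * ∏ i, x i ^ (α + Pi.single j 1 : Fin n → ℕ) i)) t := by
      intro α hα
      rw [mem_multiIndices] at hα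
      have hsm : ContDiff ℝ (∑ j, α j + 1 : ℕ) g := hg.of_le (by rw [hα]; exact_mod_cast hd)
      have hdiff : Differentiable ℝ (multiDeriv α g) :=
        (contDiff_multiDeriv α hsm).differentiable (by norm_num)
      have h1 : HasDerivAt (fun t : ℝ => multiDeriv α g (t • x))
          (fderiv ℝ (multiDeriv α g) (t • x) ((1 : ℝ) • x)) t :=
        (hdiff (t • x)).hasFDerivAt.comp_hasDerivAt t ((hasDerivAt_id t).smul_const x)
      rw [one_smul, fderiv_eq_sum_partialDeriv] at h1
      refine ((h1.mul_const (∏ j, x j ^ α j)).const_mul _).congr_deriv ?_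
      rw [← Finset.mul_sum, Finset.sum_mul]
      congr 1
      refine Finset.sum_congr rfl fun j _ => ?_
      rw [partialDeriv_multiDeriv α j hsm, prod_pow_add_single]
      ring
    exact (HasDerivAt.fun_sum hder).deriv

/-- Lagrange's form of the remainder for `t ↦ g (t • x)` between `0` and `1`; the intermediate point
is irrelevant because the derivative bounds are global. -/
theorem abs_taylorRem_le {k : ℕ} {g : (Fin n → ℝ) → ℝ} (hg : ContDiff ℝ (k + 1 : ℕ) g)
    (hg0 : g 0 = 0) {M : (Fin n → ℕ) → ℝ}
    (hM : ∀ ρ ∈ multiIndices n (k + 1), ∀ x, |multiDeriv ρ g x| ≤ M ρ) (x : Fin n → ℝ) :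
    |taylorRem k g x| ≤
      ∑ ρ ∈ multiIndices n (k + 1), M ρ / (multiFactorial ρ : ℝ) * |∏ j, x j ^ ρ j| := by
  set ψ : ℝ → ℝ := fun t => g (t • x) with hψ
  have hψc : ContDiff ℝ (k + 1 : ℕ) ψ := hg.comp (contDiff_id.smul contDiff_const)
  obtain ⟨t, -, ht⟩ := taylor_mean_remainder_lagrange_iteratedDeriv (f := ψ) (n := k)
    (zero_ne_one' ℝ) (by exact_mod_cast hψc.contDiffOn)
  have hT : taylorWithinEval ψ k (Set.uIcc 0 1) 0 1 = taylorPoly k g x := by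
    -- `taylorPoly` starts at degree `1`; the constant term is zero because `g 0 = 0`.
    have hr : Finset.range (k + 1) = insert 0 (Finset.Icc 1 k) := by
      ext d; simp; omega
    have h0 : ψ 0 = 0 := by simp [hψ, hg0]
    rw [taylor_within_apply, hr, Finset.sum_insert (by simp), taylorPoly]
    simp only [iteratedDerivWithin_zero, h0, smul_zero, zero_add, sub_zero, one_pow, mul_one]
    refine Finset.sum_congr rfl fun d hd => ?_
    rw [Finset.mem_Icc] at hd
    have hsm : ContDiffAt ℝ d ψ 0 := (hψc.of_le (by norm_cast; omega)).contDiffAt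
    rw [iteratedDerivWithin_eq_iteratedDeriv (uniqueDiffOn_uIcc (zero_ne_one' ℝ)) hsm (by simp),
      iteratedDeriv_comp_smul hg x d (by omega), smul_eq_mul, Finset.mul_sum]
    simp only [zero_smul]
    refine Finset.sum_congr rfl fun α _ => ?_
    have : (d ! : ℝ) ≠ 0 := by positivity
    field_simp
  have hL : taylorRem k g x = ∑ ρ ∈ multiIndices n (k + 1),
      (multiFactorial ρ : ℝ)⁻¹ * (multiDeriv ρ g (t • x) * ∏ j, x j ^ ρ j) := by
    rw [taylorRem, ← hT]
    have h1 : ψ 1 = g x := by simp [hψ]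
    rw [← h1, ht, iteratedDeriv_comp_smul hg x _ le_rfl]
    have : ((k + 1)! : ℝ) ≠ 0 := by positivity
    simp only [sub_zero, one_pow, mul_one, Finset.sum_div]
    refine Finset.sum_congr rfl fun ρ _ => ?_
    field_simp
  rw [hL]
  refine (Finset.abs_sum_le_sum_abs _ _).trans (Finset.sum_le_sum fun ρ hρ => ?_)
  rw [abs_mul, abs_mul, abs_inv, Nat.abs_cast, div_eq_inv_mul, mul_assoc]
  gcongr
  exact hM ρ hρ _

end Taylor

/-! ### Lyapunov's direct method -/

section Lyapunov

open Set

/-- A bounded globally Lipschitz vector field has forward solutions on `[0, ∞)`. -/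
lemma exists_isIntegralCurveOn_Ici {E : Type*} [NormedAddCommGroup E] [NormedSpace ℝ E]
    [CompleteSpace E] {v : E → E} {K L : ℝ≥0} (hK : LipschitzWith K v) (hL : ∀ x, ‖v x‖ ≤ L)
    (x₀ : E) : ∃ γ : ℝ → E, γ 0 = x₀ ∧ IsIntegralCurveOn γ (fun _ => v) (Ici 0) := by
  have hloc : ∀ j : ℕ, ∃ γ : ℝ → E, γ 0 = x₀ ∧
      ∀ t ∈ Icc (0 : ℝ) j, HasDerivWithinAt γ (v (γ t)) (Icc 0 j) t := by
    intro j
    -- A solution of speed at most `L` stays within distance `L * j` of `x₀` up to time `j`, so this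
    -- radius puts no limit on the existence time.
    have hpl : IsPicardLindelof (fun _ => v) (tmin := 0) (tmax := j)
        ⟨0, left_mem_Icc.2 j.cast_nonneg⟩ x₀ (L * j) 0 L K :=
      IsPicardLindelof.of_time_independent (fun x _ => hL x) hK.lipschitzOnWith (by simp)
    exact hpl.exists_eq_forall_mem_Icc_hasDerivWithinAt₀
  choose γ hγ0 hγ using hloc
  have huniq : ∀ i j : ℕ, i ≤ j → EqOn (γ i) (γ j) (Icc 0 i) := by
    intro i j hij
    have hsub : Icc (0 : ℝ) i ⊆ Icc 0 j := Icc_subset_Icc_right (by exact_mod_cast hij)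
    refine ODE_solution_unique (v := fun _ => v) (fun _ => hK)
      (fun t ht => (hγ i t ht).continuousWithinAt) ?_
      (fun t ht => ((hγ j t (hsub ht)).mono hsub).continuousWithinAt) ?_
      ((hγ0 i).trans (hγ0 j).symm)
    · intro t ht
      exact (hγ i t (Ico_subset_Icc_self ht)).mono_of_mem_nhdsWithin (Icc_mem_nhdsGE_of_mem ht)
    · intro t ht
      exact ((hγ j t (hsub (Ico_subset_Icc_self ht))).mono hsub).mono_of_mem_nhdsWithin
        (Icc_mem_nhdsGE_of_mem ht)
  -- The solutions on `[0, j]` are glued by uniqueness. The index `⌊t⌋₊ + 1` keeps `t` strictly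
  -- inside its interval, so that derivatives within `[0, j]` are derivatives within `[0, ∞)`.
  set Γ : ℝ → E := fun t => γ (⌊t⌋₊ + 1) t with hΓ
  have heq : ∀ j : ℕ, ∀ t ∈ Ico (0 : ℝ) j, Γ t = γ j t := by
    intro j t ht
    have h1 : ⌊t⌋₊ + 1 ≤ j := (Nat.floor_lt ht.1).2 ht.2
    exact huniq _ _ h1 ⟨ht.1, by push_cast; exact (Nat.lt_floor_add_one t).le⟩
  refine ⟨Γ, ?_, ?_⟩
  · simpa using (heq 1 0 (by simp)).trans (hγ0 1)
  · intro t ht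
    rw [mem_Ici] at ht
    set j := ⌊t⌋₊ + 1 with hj
    have htj : t < j := by rw [hj]; push_cast; exact Nat.lt_floor_add_one t
    have hnhds : Ico (0 : ℝ) j ∈ 𝓝[Ici 0] t :=
      mem_nhdsWithin.2 ⟨Iio j, isOpen_Iio, htj, fun s hs => ⟨hs.2, hs.1⟩⟩
    have h1 : HasDerivWithinAt (γ j) (v (γ j t)) (Ici 0) t :=
      (hγ j t ⟨ht, htj.le⟩).mono_of_mem_nhdsWithin (mem_of_superset hnhds Ico_subset_Icc_self)
    have h2 := h1.congr_of_eventuallyEq (f₁ := Γ)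
      (eventually_of_mem hnhds fun s hs => heq j s hs) (heq j t ⟨ht, htj⟩)
    rwa [← heq j t ⟨ht, htj⟩] at h2

variable {n : ℕ} {F : (Fin n → ℝ) → (Fin n → ℝ)} {V : (Fin n → ℝ) → ℝ}

lemma antitoneOn_comp_integralCurve {v : (Fin n → ℝ) → (Fin n → ℝ)} (hV : Differentiable ℝ V)
    {c : ℝ} (hdec : ∀ x, fderiv ℝ V x (v x) ≤ -c * V x) {γ : ℝ → (Fin n → ℝ)}
    (hγ : IsIntegralCurveOn γ (fun _ => v) (Ici 0)) :
    AntitoneOn (fun t => Real.exp (c * t) * V (γ t)) (Ici 0) := by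
  have hder : ∀ t ∈ Ici (0 : ℝ), HasDerivWithinAt (fun t => Real.exp (c * t) * V (γ t))
      (Real.exp (c * t) * (c * 1) * V (γ t) + Real.exp (c * t) * fderiv ℝ V (γ t) (v (γ t)))
      (Ici 0) t := by
    intro t ht
    have h1 : HasDerivAt (fun t => Real.exp (c * t)) (Real.exp (c * t) * (c * 1)) t :=
      ((hasDerivAt_id t).const_mul c).exp
    exact h1.hasDerivWithinAt.mul ((hV (γ t)).hasFDerivAt.comp_hasDerivWithinAt t (hγ t ht))
  refine antitoneOn_of_hasDerivWithinAt_nonpos (convex_Ici 0)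
    (fun t ht => (hder t ht).continuousWithinAt)
    (fun t ht => (hder t (interior_subset ht)).mono interior_subset) ?_
  intro t _
  have h2 := hdec (γ t)
  have h3 := Real.exp_pos (c * t)
  nlinarith

lemma comp_integralCurve_le (hV : Differentiable ℝ V) {c : ℝ}
    (hdec : ∀ x, fderiv ℝ V x (F x) ≤ -c * V x) {γ : ℝ → (Fin n → ℝ)}
    (hγ : IsIntegralCurveOn γ (fun _ => F) (Ici 0)) {t : ℝ} (ht : 0 ≤ t) :
    V (γ t) ≤ Real.exp (-(c * t)) * V (γ 0) := by
  have h := antitoneOn_comp_integralCurve hV hdec hγ self_mem_Ici ht ht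
  simp only [mul_zero, Real.exp_zero, one_mul] at h
  calc V (γ t) = Real.exp (-(c * t)) * (Real.exp (c * t) * V (γ t)) := by
        rw [← mul_assoc, ← Real.exp_add]; simp
    _ ≤ _ := by gcongr

/-- `F` need not be globally Lipschitz, so it is multiplied by a bump function. The cut-off is
nonnegative, hence `V` still does not increase; the trajectory stays where the cut-off is `1` and
thus solves the original equation. -/
lemma exists_forward_solution (hF : ContDiff ℝ 1 F) (hV : Differentiable ℝ V) {a : ℝ}
    (ha : 0 < a) (hlow : ∀ x, a * ‖x‖ ^ 2 ≤ V x) (hdec : ∀ x, fderiv ℝ V x (F x) ≤ 0)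
    (x₀ : Fin n → ℝ) :
    ∃ γ : ℝ → (Fin n → ℝ), γ 0 = x₀ ∧ IsIntegralCurveOn γ (fun _ => F) (Ici 0) := by
  -- By the quadratic lower bound, the sublevel set `V ≤ V x₀` lies in the ball of radius `√(V x₀ /
  -- a)`; the `1` makes `r` positive.
  set r : ℝ := √(V x₀ / a) + 1 with hr
  have hr0 : 0 < r := by positivity
  let b : ContDiffBump (0 : Fin n → ℝ) := ⟨r, r + 1, hr0, by linarith⟩
  set v : (Fin n → ℝ) → (Fin n → ℝ) := fun x => b x • F x with hv
  have hvc : ContDiff ℝ 1 v := b.contDiff.smul hF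
  have hvs : HasCompactSupport v := b.hasCompactSupport.smul_right
  obtain ⟨K, hK⟩ := hvc.lipschitzWith_of_hasCompactSupport hvs (by norm_num)
  obtain ⟨C, hC⟩ := hvs.exists_bound_of_continuous hvc.continuous
  obtain ⟨γ, hγ0, hγ⟩ := exists_isIntegralCurveOn_Ici hK (L := C.toNNReal)
    (fun x => (hC x).trans (Real.le_coe_toNNReal C)) x₀
  refine ⟨γ, hγ0, fun t ht => ?_⟩
  have hVt : V (γ t) ≤ V x₀ := by
    have := comp_integralCurve_le (c := 0) hV (F := v) ?_ hγ ht
    · simpa [hγ0] using this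
    · intro x
      simp only [hv, map_smul, smul_eq_mul, neg_zero, zero_mul]
      exact mul_nonpos_of_nonneg_of_nonpos b.nonneg (hdec x)
  have hball : γ t ∈ Metric.closedBall (0 : Fin n → ℝ) r := by
    rw [mem_closedBall_zero_iff]
    have h1 : ‖γ t‖ ≤ √(V x₀ / a) := by
      apply Real.le_sqrt_of_sq_le
      rw [le_div_iff₀ ha, mul_comm]
      exact (hlow _).trans hVt
    linarith
  have hone : v (γ t) = F (γ t) := by
    simp [hv, b.one_of_mem_closedBall hball]
  exact (hγ t ht).congr_deriv hone

theorem globallyAsymptoticallyStable_of_lyapunov (hF : ContDiff ℝ 1 F) (hF0 : F 0 = 0)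
    (hV : Differentiable ℝ V) (hV0 : V 0 = 0) {a c : ℝ} (ha : 0 < a) (hc : 0 < c)
    (hlow : ∀ x, a * ‖x‖ ^ 2 ≤ V x) (hdec : ∀ x, fderiv ℝ V x (F x) ≤ -c * V x) :
    GloballyAsymptoticallyStable F where
  equilibrium := hF0
  exists_solution := exists_forward_solution hF hV ha hlow fun x => by
    have h1 := hdec x
    have h2 : 0 ≤ V x := (by positivity : 0 ≤ a * ‖x‖ ^ 2).trans (hlow x)
    nlinarith
  stable := by
    intro U hU
    obtain ⟨e, he, heU⟩ := Metric.mem_nhds_iff.1 hU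
    refine ⟨{x | V x < a * e ^ 2}, ?_, ?_⟩
    · apply hV.continuous.continuousAt.eventually_lt continuousAt_const
      rw [hV0]; positivity
    · intro γ hγ hγ0 t ht
      apply heU
      rw [mem_ball_zero_iff]
      have h1 := comp_integralCurve_le hV hdec hγ ht
      have h2 : 0 ≤ V (γ 0) := (by positivity : 0 ≤ a * ‖γ 0‖ ^ 2).trans (hlow _)
      have h3 : Real.exp (-(c * t)) ≤ 1 := Real.exp_le_one_iff.2 (by nlinarith)
      have h4 : a * ‖γ t‖ ^ 2 < a * e ^ 2 :=
        (hlow _).trans_lt (h1.trans_lt ((mul_le_of_le_one_left h2 h3).trans_lt hγ0))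
      exact lt_of_pow_lt_pow_left₀ 2 he.le (lt_of_mul_lt_mul_left h4 ha.le)
  attractive := by
    intro γ hγ
    have hlim : Tendsto (fun t => Real.exp (-(c * t)) * V (γ 0) / a) atTop (𝓝 0) := by
      have h1 : Tendsto (fun t => Real.exp (-(c * t))) atTop (𝓝 0) :=
        Real.tendsto_exp_neg_atTop_nhds_zero.comp (tendsto_id.const_mul_atTop hc)
      simpa using (h1.mul_const (V (γ 0))).div_const a
    have hsq : Tendsto (fun t => ‖γ t‖ ^ 2) atTop (𝓝 0) := by
      refine squeeze_zero' (Eventually.of_forall fun t => by positivity) ?_ hlim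
      filter_upwards [eventually_ge_atTop 0] with t ht
      rw [le_div_iff₀ ha, mul_comm]
      exact (hlow _).trans (comp_integralCurve_le hV hdec hγ ht)
    rw [tendsto_zero_iff_norm_tendsto_zero]
    have := hsq.sqrt
    simpa [Real.sqrt_sq] using this

end Lyapunov

/-! ### Gaussian measures on `ℝᵈ` -/

section Gaussian

variable {d : ℕ}

lemma lintegral_fin_prod_eq_prod : ∀ {d : ℕ} {f : Fin d → ℝ → ℝ≥0∞}, (∀ i, Measurable (f i)) →
    ∫⁻ x : Fin d → ℝ, ∏ i, f i (x i) = ∏ i, ∫⁻ x, f i x := by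
  intro d
  induction d with
  | zero => intro f _; simp [volume_pi]
  | succ d ih =>
    intro f hf
    have hm := (volume_preserving_piFinSuccAbove (fun _ : Fin (d + 1) => ℝ) 0).symm
    rw [← hm.lintegral_comp_emb (MeasurableEquiv.measurableEmbedding _), Fin.prod_univ_succ,
      ← ih (fun i => hf i.succ)]
    rw [← lintegral_prod_mul (hf 0).aemeasurable
      (Finset.measurable_prod _ fun i _ => (hf i.succ).comp (measurable_pi_apply i)).aemeasurable]
    simp [Fin.prod_univ_succ, MeasurableEquiv.piFinSuccAbove_symm_apply, Fin.insertNthEquiv]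
    rfl

lemma pi_withDensity {f : ℝ → ℝ≥0∞} (hf : Measurable f) [SigmaFinite (volume.withDensity f)] :
    Measure.pi (fun _ : Fin d => volume.withDensity f) =
      volume.withDensity fun x : Fin d → ℝ => ∏ i, f (x i) := by
  refine Measure.pi_eq fun s hs => ?_
  rw [withDensity_apply _ (MeasurableSet.univ_pi hs), ← lintegral_indicator (.univ_pi hs)]
  have h1 : (Set.univ.pi s).indicator (fun x : Fin d → ℝ => ∏ i, f (x i)) =
      fun x => ∏ i, (s i).indicator f (x i) := by
    ext x
    by_cases hx : x ∈ Set.univ.pi s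
    · rw [Set.indicator_of_mem hx]
      exact Finset.prod_congr rfl fun i _ => (Set.indicator_of_mem (hx i trivial) f).symm
    · rw [Set.indicator_of_notMem hx]
      obtain ⟨i, hi⟩ : ∃ i, x i ∉ s i := by simpa [Set.mem_pi] using hx
      exact (Finset.prod_eq_zero (Finset.mem_univ i) (Set.indicator_of_notMem hi f)).symm
  rw [h1, lintegral_fin_prod_eq_prod fun i => hf.indicator (hs i)]
  refine Finset.prod_congr rfl fun i _ => ?_
  rw [lintegral_indicator (hs i), withDensity_apply _ (hs i)]

lemma exists_transpose_mul_self_eq {Λ : Matrix (Fin d) (Fin d) ℝ} (hΛ : Λ.PosDef) :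
    ∃ B : Matrix (Fin d) (Fin d) ℝ, B.det ≠ 0 ∧ Λ = Bᵀ * B := by
  open scoped MatrixOrder in
  obtain ⟨B, hB⟩ := CStarAlgebra.nonneg_iff_eq_star_mul_self.mp hΛ.posSemidef.nonneg
  rw [star_eq_conjTranspose, conjTranspose_eq_transpose_of_trivial] at hB
  refine ⟨B, fun h => ?_, hB⟩
  have := hΛ.det_pos
  rw [hB, det_mul, h] at this
  simp at this

/-- The density `exp (-(θ - μ)ᵀ Λ (θ - μ) / 2)`, normalized, is the law of a standard Gaussian vector
under an affine change of variables which turns `(θ - μ)ᵀ Λ (θ - μ)` into `|v|²`. -/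
theorem normalized_gaussian_density {Λ : Matrix (Fin d) (Fin d) ℝ} (hΛ : Λ.PosDef)
    (μ : Fin d → ℝ) {C : ℝ} (hC : 0 < C) {p : (Fin d → ℝ) → ℝ≥0∞}
    (hp : ∀ θ, p θ = ENNReal.ofReal (C * Real.exp (-((θ - μ) ⬝ᵥ (Λ *ᵥ (θ - μ))) / 2))) :
    IsProbabilityMeasure ((∫⁻ θ, p θ)⁻¹ • volume.withDensity p) ∧
    ∀ q : ℝ, ((∫⁻ θ, p θ)⁻¹ • volume.withDensity p) {θ | (θ - μ) ⬝ᵥ (Λ *ᵥ (θ - μ)) ≤ q} =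
      chiSquared d (Set.Iic q) := by
  obtain ⟨B, hB, rfl⟩ := exists_transpose_mul_self_eq hΛ
  have hquad : ∀ h, h ⬝ᵥ ((Bᵀ * B) *ᵥ h) = ∑ i, (B *ᵥ h) i ^ 2 := by
    intro h
    rw [← mulVec_mulVec, dotProduct_mulVec, vecMul_transpose, dotProduct]
    simp [sq]
  set T : (Fin d → ℝ) → (Fin d → ℝ) := fun θ => B *ᵥ (θ - μ) with hT
  have hTm : Measurable T := by
    have : Continuous T := by simp only [hT]; fun_prop
    exact this.measurable
  -- `k` is the Jacobian factor of the whitening map and `c`, below, is the ratio of the prefactor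
  -- `C` to that of the standard Gaussian. The unnormalized measure is pushed forward to `c * k`
  -- times the standard Gaussian law, so the total mass is `c * k` and normalization cancels it.
  set k : ℝ≥0∞ := ENNReal.ofReal |(B.det)⁻¹| with hk
  have hk0 : k ≠ 0 := by simp [hk, hB]
  have hmap : (volume : Measure (Fin d → ℝ)).map T = k • volume := by
    rw [hk, ← Real.map_matrix_volume_pi_eq_smul_volume_pi hB]
    have : T = (toLin' B) ∘ fun θ => θ - μ := by ext θ; simp [hT]
    have hcB : Continuous (toLin' B) := (toLin' B).continuous_of_finiteDimensional
    rw [this, ← Measure.map_map hcB.measurable (measurable_sub_const μ),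
      (measurePreserving_sub_right volume μ).map_eq]
  set ν : Measure (Fin d → ℝ) := Measure.pi fun _ => gaussianReal 0 1 with hν
  set c : ℝ≥0∞ := ENNReal.ofReal (C * ((√(2 * Real.pi))⁻¹ ^ d)⁻¹) with hc
  have hc0 : c ≠ 0 := by
    have : 0 < C * ((√(2 * Real.pi))⁻¹ ^ d)⁻¹ := by positivity
    simpa [hc] using this
  have hpT : ∀ θ, p θ = c * ∏ i, gaussianPDF 0 1 (T θ i) := by
    intro θ
    simp only [gaussianPDF]
    rw [hp, hquad, ← ENNReal.ofReal_prod_of_nonneg fun i _ => gaussianPDFReal_nonneg _ _ _, hc,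
      ← ENNReal.ofReal_mul (by positivity)]
    congr 1
    simp only [gaussianPDFReal, Finset.prod_mul_distrib, Finset.prod_const, Finset.card_univ,
      Fintype.card_fin, ← Real.exp_sum, NNReal.coe_one, mul_one, sub_zero]
    have h1 : (√(2 * Real.pi))⁻¹ ^ d ≠ 0 := by positivity
    rw [mul_assoc, ← mul_assoc (((√(2 * Real.pi))⁻¹ ^ d)⁻¹), inv_mul_cancel₀ h1, one_mul,
      ← Finset.sum_div, Finset.sum_neg_distrib]
  have hνd : ν = volume.withDensity fun x => ∏ i, gaussianPDF 0 1 (x i) := by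
    have h1 := gaussianReal_of_var_ne_zero 0 (v := 1) one_ne_zero
    have : SigmaFinite (volume.withDensity (gaussianPDF 0 1)) := by
      rw [← h1]; infer_instance
    rw [hν, h1, pi_withDensity (measurable_gaussianPDF 0 1)]
  have hgm : Measurable fun x : Fin d → ℝ => ∏ i, gaussianPDF 0 1 (x i) :=
    Finset.measurable_prod _ fun i _ => (measurable_gaussianPDF 0 1).comp (measurable_pi_apply i)
  have hpre : ∀ s, MeasurableSet s → volume.withDensity p (T ⁻¹' s) = c * k * ν s := by
    intro s hs
    rw [withDensity_apply _ (hTm hs), hνd, withDensity_apply _ hs]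
    simp_rw [hpT]
    have hgT : Measurable fun θ => ∏ i, gaussianPDF 0 1 (T θ i) := hgm.comp hTm
    rw [lintegral_const_mul _ hgT,
      ← setLIntegral_map hs hgm hTm, hmap, Measure.restrict_smul, lintegral_smul_measure,
      smul_eq_mul, mul_assoc]
  have htot : ∫⁻ θ, p θ = c * k := by
    have := hpre Set.univ .univ
    simpa using this
  have hck0 : c * k ≠ 0 := mul_ne_zero hc0 hk0
  have hckt : c * k ≠ ∞ := ENNReal.mul_ne_top ENNReal.ofReal_ne_top ENNReal.ofReal_ne_top
  have hpost : ∀ s, MeasurableSet s →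
      ((∫⁻ θ, p θ)⁻¹ • volume.withDensity p) (T ⁻¹' s) = ν s := by
    intro s hs
    rw [Measure.smul_apply, hpre s hs, htot, smul_eq_mul, ← mul_assoc,
      ENNReal.inv_mul_cancel hck0 hckt, one_mul]
  refine ⟨⟨?_⟩, fun q => ?_⟩
  · have := hpost Set.univ .univ
    simpa using this
  · have hsm : Measurable fun v : Fin d → ℝ => ∑ i, v i ^ 2 := by fun_prop
    rw [chiSquared, Measure.map_apply hsm measurableSet_Iic, ← hpost _ (hsm measurableSet_Iic)]
    congr 1
    ext θ
    simp [hquad, hT]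

lemma isProbabilityMeasure_chiSquared (d : ℕ) : IsProbabilityMeasure (chiSquared d) :=
  Measure.isProbabilityMeasure_map
    (by fun_prop : Measurable fun v : Fin d → ℝ => ∑ i, v i ^ 2).aemeasurable

/-- The infimum defining the quantile is attained because distribution functions are
right-continuous. The limits of the distribution function at `±∞` make the set nonempty (`δ < 1`)
and bounded below (`0 < δ`), so that `sInf` is a genuine infimum. -/
lemma le_chiSquared_quantile (d : ℕ) {δ : ℝ} (hδ₀ : 0 < δ) (hδ₁ : δ < 1) :
    ENNReal.ofReal δ ≤ chiSquared d (Set.Iic (chiSquaredQuantile d δ)) := by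
  have := isProbabilityMeasure_chiSquared d
  set G := cdf (chiSquared d) with hG
  have hset : {q : ℝ | ENNReal.ofReal δ ≤ chiSquared d (Set.Iic q)} = {q | δ ≤ G q} := by
    ext q
    rw [Set.mem_ofPred_eq, Set.mem_ofPred_eq, ← ofReal_cdf,
      ENNReal.ofReal_le_ofReal_iff (cdf_nonneg _ _)]
  rw [chiSquaredQuantile, hset, ← ofReal_cdf]
  apply ENNReal.ofReal_le_ofReal
  set S := {q | δ ≤ G q} with hS
  have hne : S.Nonempty := by
    obtain ⟨q, hq⟩ := ((tendsto_cdf_atTop (chiSquared d)).eventually (lt_mem_nhds hδ₁)).exists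
    exact ⟨q, hq.le⟩
  have hbdd : BddBelow S := by
    obtain ⟨q, hq⟩ := ((tendsto_cdf_atBot (chiSquared d)).eventually (gt_mem_nhds hδ₀)).exists
    refine ⟨q, fun r hr => ?_⟩
    by_contra! h
    exact absurd (hr.trans (monotone_cdf _ h.le)) (not_le.2 hq)
  by_contra! hlt
  have hcont := (G.right_continuous (sInf S)).eventually (gt_mem_nhds hlt)
  obtain ⟨u, hu, hus⟩ := (mem_nhdsGE_iff_exists_Ico_subset).1 hcont
  obtain ⟨q, hqS, hqu⟩ := exists_lt_of_csInf_lt hne hu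
  have h1 : G q < δ := hus ⟨csInf_le hbdd hqS, hqu⟩
  exact absurd hqS (not_le.2 h1)

end Gaussian

/-! ### The remainder bound -/

section Remainder

variable {n nu nΘ : ℕ} {𝒦 : Knowledge n nu nΘ} {f : (Fin nΘ → ℝ) → (Fin n → ℝ) → (Fin n → ℝ)}
  {B : (Fin nΘ → ℝ) → Matrix (Fin n) (Fin nu) (Poly n)} {R : (Fin n → ℝ) → (Fin n → ℝ)}

lemma Knowledge.IsSystemFamily.contDiff_apply (hsys : 𝒦.IsSystemFamily f B R)
    (θ : Fin nΘ → ℝ) (i : Fin n) : ContDiff ℝ (𝒦.k + 1 : ℕ) fun y => f θ y i :=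
  (contDiff_pi.1 (by exact_mod_cast hsys.contDiff θ)) i

lemma Knowledge.IsSystemFamily.abs_remainder_le (hsys : 𝒦.IsSystemFamily f B R)
    (x : Fin n → ℝ) (i : Fin n) :
    |R x i| ≤ ∑ ρ ∈ multiIndices n (𝒦.k + 1),
      𝒦.M i ρ / (multiFactorial ρ : ℝ) * |∏ j, x j ^ ρ j| := by
  -- `R` is the same for all coefficients, so any member of the family serves; `0` is arbitrary.
  rw [← hsys.remainder 0 i x]
  exact abs_taylorRem_le (hsys.contDiff_apply 0 i) (by simp [hsys.map_zero])
    (fun ρ hρ y => hsys.deriv_bound 0 i ρ hρ y) x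

lemma Knowledge.IsSystemFamily.abs_remainder_le_sqrt (hsys : 𝒦.IsSystemFamily f B R)
    (x : Fin n → ℝ) (i : Fin n) : |R x i| ≤ √(𝒦.remAbs i x) := by
  rw [Knowledge.remAbs, Real.sqrt_sq_eq_abs]
  exact (hsys.abs_remainder_le x i).trans (le_abs_self _)

lemma eval_scaledMonom (α : Fin n → ℕ) (x : Fin n → ℝ) :
    MvPolynomial.eval x (scaledMonom α) = (multiFactorial α : ℝ)⁻¹ * ∏ j, x j ^ α j := by
  simp [scaledMonom, monom]

lemma Knowledge.IsSystemFamily.sum_sq_remainder_le (hsys : 𝒦.IsSystemFamily f B R)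
    (x : Fin n → ℝ) :
    ∑ i, R x i ^ 2 ≤ ∑ ρ, 𝒦.dDiag ρ.1 * evalVec 𝒦.omegaVec x ρ ^ 2 := by
  set w : (Fin n → ℕ) → ℝ := fun ρ => (multiFactorial ρ : ℝ)⁻¹ * ∏ j, x j ^ ρ j with hw
  have hrow : ∀ i, R x i ^ 2 ≤
      ∑ ρ ∈ multiIndices n (𝒦.k + 1), (𝒦.kappa i : ℝ) * 𝒦.M i ρ ^ 2 * w ρ ^ 2 := by
    intro i
    -- Vanishing bounds are discarded before Cauchy–Schwarz, so that the factor is the number `κ_i`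
    -- of remaining terms.
    set I := (multiIndices n (𝒦.k + 1)).filter fun ρ => 𝒦.M i ρ ≠ 0 with hI
    have h1 : |R x i| ≤ ∑ ρ ∈ I, 𝒦.M i ρ * |w ρ| := by
      refine (hsys.abs_remainder_le x i).trans (le_of_eq ?_)
      rw [hI, Finset.sum_filter_of_ne]
      · refine Finset.sum_congr rfl fun ρ _ => ?_
        rw [hw]
        simp only [abs_mul, abs_inv, Nat.abs_cast]
        ring
      · intro ρ _ h h0
        simp [h0] at h
    calc R x i ^ 2 = |R x i| ^ 2 := (sq_abs _).symm
      _ ≤ (∑ ρ ∈ I, 𝒦.M i ρ * |w ρ|) ^ 2 := by gcongr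
      _ ≤ (I.card : ℝ) * ∑ ρ ∈ I, (𝒦.M i ρ * |w ρ|) ^ 2 := sq_sum_le_card_mul_sum_sq
      _ = ∑ ρ ∈ I, (𝒦.kappa i : ℝ) * 𝒦.M i ρ ^ 2 * w ρ ^ 2 := by
        rw [Finset.mul_sum]
        refine Finset.sum_congr rfl fun ρ _ => ?_
        rw [mul_pow, sq_abs, mul_assoc]
        rfl
      _ ≤ _ := Finset.sum_le_sum_of_subset_of_nonneg (Finset.filter_subset _ _)
        fun ρ _ _ => by positivity
  refine (Finset.sum_le_sum fun i _ => hrow i).trans (le_of_eq ?_)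
  rw [Finset.sum_comm]
  have h2 : ∑ ρ, 𝒦.dDiag ρ.1 * evalVec 𝒦.omegaVec x ρ ^ 2 =
      ∑ ρ ∈ 𝒦.remIndices, 𝒦.dDiag ρ * w ρ ^ 2 := by
    rw [← Finset.sum_coe_sort 𝒦.remIndices fun ρ => 𝒦.dDiag ρ * w ρ ^ 2]
    refine Finset.sum_congr rfl fun ρ _ => ?_
    rw [evalVec, Knowledge.omegaVec, eval_scaledMonom]
  rw [h2, Knowledge.remIndices, Finset.sum_filter_of_ne]
  · refine Finset.sum_congr rfl fun ρ _ => ?_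
    rw [Knowledge.dDiag, Finset.sum_mul]
  · intro ρ _ h h0
    simp [h0] at h

lemma Knowledge.dDiag_nonneg (ρ : Fin n → ℕ) : 0 ≤ 𝒦.dDiag ρ :=
  Finset.sum_nonneg fun i _ => by positivity

lemma Knowledge.dDiag_pos (ρ : 𝒦.remIndices) : 0 < 𝒦.dDiag ρ.1 :=
  lt_of_le_of_ne (Knowledge.dDiag_nonneg _) (Finset.mem_filter.1 ρ.2).2.symm

end Remainder

/-! ### The posterior distribution -/

section Posterior

variable {n nu nΘ N : ℕ} (𝒦 : Knowledge n nu nΘ) (data : Samples n nu N) (σ : ℝ)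
  (R : (Fin n → ℝ) → (Fin n → ℝ))

/-- The mean `σ⁻² Σ_Θ ∑_s Z(x_s, u_s)ᵀ (ẋ_s - R(x_s))` of the posterior distribution. -/
noncomputable def Knowledge.posteriorMean : Fin nΘ → ℝ :=
  (σ ^ 2)⁻¹ • ((𝒦.precision data σ)⁻¹ *ᵥ
    ∑ s, (𝒦.regressor (data.x s) (data.u s))ᵀ *ᵥ (data.xdot s - R (data.x s)))

variable {𝒦 data σ R}

lemma Knowledge.posDef_precision (hσ : 0 < σ) (hpe : (𝒦.gram data).PosDef) :
    (𝒦.precision data σ).PosDef :=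
  hpe.smul (by positivity : 0 < (σ ^ 2)⁻¹)

/-- The normal equations of least squares. They annihilate the cross term when the square is
completed in `Knowledge.sum_sq_residual`. -/
lemma Knowledge.sum_transpose_mulVec_residual (hσ : 0 < σ) (hpe : (𝒦.gram data).PosDef) :
    ∑ s, (𝒦.regressor (data.x s) (data.u s))ᵀ *ᵥ (data.xdot s - R (data.x s) -
      𝒦.regressor (data.x s) (data.u s) *ᵥ 𝒦.posteriorMean data σ R) = 0 := by
  have hdet : IsUnit (𝒦.precision data σ).det :=
    (isUnit_iff_isUnit_det _).1 (Knowledge.posDef_precision hσ hpe).isUnit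
  have hs : (σ ^ 2) ≠ 0 := by positivity
  have h1 : 𝒦.gram data *ᵥ 𝒦.posteriorMean data σ R =
      ∑ s, (𝒦.regressor (data.x s) (data.u s))ᵀ *ᵥ (data.xdot s - R (data.x s)) := by
    have h2 : 𝒦.gram data = σ ^ 2 • 𝒦.precision data σ := by
      rw [Knowledge.precision, smul_smul, mul_inv_cancel₀ hs, one_smul]
    rw [h2, Knowledge.posteriorMean, mulVec_smul, smul_mulVec, smul_smul, inv_mul_cancel₀ hs,
      one_smul, mulVec_mulVec, mul_nonsing_inv _ hdet, one_mulVec]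
  simp_rw [mulVec_sub _ _ (𝒦.regressor _ _ *ᵥ _), Finset.sum_sub_distrib, ← h1, Knowledge.gram,
    mulVec_mulVec, sum_mulVec, sub_self]

lemma Knowledge.sum_sq_residual (hσ : 0 < σ) (hpe : (𝒦.gram data).PosDef) (θ : Fin nΘ → ℝ) :
    ∑ s, ∑ i, (data.xdot s i - ((𝒦.regressor (data.x s) (data.u s) *ᵥ θ) i +
        R (data.x s) i)) ^ 2 =
      ∑ s, ∑ i, (data.xdot s i - ((𝒦.regressor (data.x s) (data.u s) *ᵥ
        𝒦.posteriorMean data σ R) i + R (data.x s) i)) ^ 2 +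
      (θ - 𝒦.posteriorMean data σ R) ⬝ᵥ
        (𝒦.gram data *ᵥ (θ - 𝒦.posteriorMean data σ R)) := by
  set μ := 𝒦.posteriorMean data σ R with hμ
  set h := θ - μ with hh
  have hθ : θ = μ + h := by simp [hh]
  have key : ∀ s, ∑ i, (data.xdot s i - ((𝒦.regressor (data.x s) (data.u s) *ᵥ θ) i +
        R (data.x s) i)) ^ 2 =
      ∑ i, (data.xdot s i - ((𝒦.regressor (data.x s) (data.u s) *ᵥ μ) i + R (data.x s) i)) ^ 2 +
      h ⬝ᵥ (((𝒦.regressor (data.x s) (data.u s))ᵀ * 𝒦.regressor (data.x s) (data.u s)) *ᵥ h) -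
      2 * (h ⬝ᵥ ((𝒦.regressor (data.x s) (data.u s))ᵀ *ᵥ (data.xdot s - R (data.x s) -
        𝒦.regressor (data.x s) (data.u s) *ᵥ μ))) := by
    intro s
    rw [← mulVec_mulVec, dotProduct_mulVec, dotProduct_mulVec h, vecMul_transpose, hθ, mulVec_add]
    simp only [dotProduct, Finset.mul_sum, ← Finset.sum_add_distrib, ← Finset.sum_sub_distrib]
    refine Finset.sum_congr rfl fun i _ => ?_
    simp only [Pi.add_apply, Pi.sub_apply]
    ring
  have hres := Knowledge.sum_transpose_mulVec_residual (R := R) hσ hpe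
  rw [← hμ] at hres
  simp_rw [key]
  rw [Finset.sum_sub_distrib, Finset.sum_add_distrib, ← Finset.mul_sum, ← dotProduct_sum,
    ← dotProduct_sum, hres, dotProduct_zero, mul_zero, sub_zero, ← sum_mulVec, Knowledge.gram]

lemma Knowledge.likelihood_eq (hσ : 0 < σ) (hpe : (𝒦.gram data).PosDef) :
    ∃ C : ℝ, 0 < C ∧ ∀ θ, 𝒦.likelihood data σ R θ =
      ENNReal.ofReal (C * Real.exp (-((θ - 𝒦.posteriorMean data σ R) ⬝ᵥ
        (𝒦.precision data σ *ᵥ (θ - 𝒦.posteriorMean data σ R))) / 2)) := by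
  have hv : ((σ ^ 2).toNNReal : ℝ) = σ ^ 2 := Real.coe_toNNReal _ (by positivity)
  have hs : (σ ^ 2) ≠ 0 := by positivity
  set μ := 𝒦.posteriorMean data σ R with hμ
  refine ⟨(∏ _s : Fin N, ∏ _i : Fin n, (√(2 * Real.pi * σ ^ 2))⁻¹) *
    Real.exp (-(∑ s, ∑ i, (data.xdot s i - ((𝒦.regressor (data.x s) (data.u s) *ᵥ μ) i +
      R (data.x s) i)) ^ 2) / (2 * σ ^ 2)), ?_, fun θ => ?_⟩
  · refine mul_pos (Finset.prod_pos fun s _ => Finset.prod_pos fun i _ => ?_) (Real.exp_pos _)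
    positivity
  · simp only [Knowledge.likelihood, gaussianPDF]
    simp_rw [← ENNReal.ofReal_prod_of_nonneg fun i _ => gaussianPDFReal_nonneg _ _ _]
    rw [← ENNReal.ofReal_prod_of_nonneg fun s _ => Finset.prod_nonneg fun i _ =>
      gaussianPDFReal_nonneg _ _ _]
    congr 1
    simp only [gaussianPDFReal, hv, Finset.prod_mul_distrib, ← Real.exp_sum]
    rw [mul_assoc _ (Real.exp _) (Real.exp _), ← Real.exp_add]
    congr 2
    simp_rw [← Finset.sum_div, Finset.sum_neg_distrib]
    rw [Knowledge.sum_sq_residual hσ hpe θ, Knowledge.precision, smul_mulVec, dotProduct_smul,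
      smul_eq_mul]
    field_simp
    ring

/-- The highest density ellipsoid of the posterior distribution of level `δ`. -/
theorem Knowledge.posterior_ellipsoid (hσ : 0 < σ) (hpe : (𝒦.gram data).PosDef) {δ : ℝ}
    (hδ₀ : 0 < δ) (hδ₁ : δ < 1) :
    IsProbabilityMeasure (𝒦.posterior data σ R) ∧
    ENNReal.ofReal δ ≤ 𝒦.posterior data σ R {θ | (θ - 𝒦.posteriorMean data σ R) ⬝ᵥ
      (𝒦.precision data σ *ᵥ (θ - 𝒦.posteriorMean data σ R)) ≤ chiSquaredQuantile nΘ δ} := by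
  obtain ⟨C, hC, hl⟩ := Knowledge.likelihood_eq (R := R) hσ hpe
  obtain ⟨h1, h2⟩ := normalized_gaussian_density (Knowledge.posDef_precision hσ hpe) _ hC hl
  exact ⟨h1, (le_chiSquared_quantile nΘ hδ₀ hδ₁).trans_eq (h2 _).symm⟩

/-- The two centres differ by `-σ⁻² Σ_Θ ∑_s Z_sᵀ R(x_s)`, so the triangle inequality applies entry
by entry. This confines the unknown posterior mean to a known box. -/
lemma Knowledge.abs_posteriorMean_sub_le (hR : ∀ x i, |R x i| ≤ √(𝒦.remAbs i x))
    (m : Fin nΘ) :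
    |𝒦.posteriorMean data σ R m - 𝒦.muOne data σ m| ≤ 𝒦.edgeLength data σ m / 2 := by
  have h1 : 𝒦.posteriorMean data σ R m - 𝒦.muOne data σ m = -((σ ^ 2)⁻¹ * ∑ s, ∑ i,
      ((𝒦.precision data σ)⁻¹ * (𝒦.regressor (data.x s) (data.u s))ᵀ) m i * R (data.x s) i) := by
    rw [Knowledge.posteriorMean, Knowledge.muOne, ← Pi.sub_apply, ← smul_sub, ← mulVec_sub,
      ← Finset.sum_sub_distrib]
    simp_rw [← mulVec_sub, sub_sub_cancel_left, mulVec_neg, Finset.sum_neg_distrib, mulVec_neg,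
      mulVec_sum, mulVec_mulVec]
    simp [mulVec, dotProduct]
  rw [h1, abs_neg, abs_mul, abs_of_nonneg (by positivity), Knowledge.edgeLength]
  have h2 : |∑ s, ∑ i, ((𝒦.precision data σ)⁻¹ *
      (𝒦.regressor (data.x s) (data.u s))ᵀ) m i * R (data.x s) i| ≤
      ∑ s, ∑ i, |((𝒦.precision data σ)⁻¹ * (𝒦.regressor (data.x s) (data.u s))ᵀ) m i| *
        √(𝒦.remAbs i (data.x s)) := by
    refine (Finset.abs_sum_le_sum_abs _ _).trans (Finset.sum_le_sum fun s _ => ?_)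
    refine (Finset.abs_sum_le_sum_abs _ _).trans (Finset.sum_le_sum fun i _ => ?_)
    rw [abs_mul]
    gcongr
    exact hR _ _
  calc _ ≤ (σ ^ 2)⁻¹ * _ := mul_le_mul_of_nonneg_left h2 (by positivity)
    _ = _ := by ring

end Posterior

/-! ### The outer ellipsoid -/

section Ellipsoid

variable {d : ℕ}

lemma symBlock_quadratic (A B C : Matrix (Fin d) (Fin d) ℝ) (b c : Fin d → ℝ) (e : ℝ)
    (θ p : Fin d → ℝ) :
    Sum.elim (Sum.elim θ p) (fun _ => 1) ⬝ᵥ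
        (symBlock A B C b c e *ᵥ Sum.elim (Sum.elim θ p) (fun _ => 1)) =
      θ ⬝ᵥ (A *ᵥ θ) + 2 * (θ ⬝ᵥ (B *ᵥ p)) + p ⬝ᵥ (C *ᵥ p) + 2 * (b ⬝ᵥ θ) + 2 * (c ⬝ᵥ p) + e := by
  have h1 : p ⬝ᵥ (Bᵀ *ᵥ θ) = θ ⬝ᵥ (B *ᵥ p) := by
    rw [mulVec_transpose, dotProduct_comm, dotProduct_mulVec]
  have h3 : (replicateCol Unit (Sum.elim b c) *ᵥ fun _ => 1) = Sum.elim b c := by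
    ext; simp [mulVec, dotProduct]
  rw [symBlock, fromBlocks_mulVec, dotProduct_block]
  simp only [Sum.elim_comp_inl, Sum.elim_comp_inr, fromBlocks_mulVec, dotProduct_add, h3,
    dotProduct_block (m := Fin d) (n := Fin d), Pi.add_comp, h1]
  simp only [dotProduct, mulVec, replicateRow_apply, of_apply, Fintype.sum_sum_type, Sum.elim_inl,
    Sum.elim_inr, Finset.univ_unique, Finset.sum_const, Finset.card_singleton, one_smul, one_mul,
    mul_one]
  simp only [mul_comm (b _), mul_comm (c _)]
  ring

/-- S-procedure: evaluated at `(θ, p, 1)`, the matrix inequality bounds the outer quadratic by `η₀`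
times the ellipsoid constraint on `θ - p` plus a combination with weights `η_i` of the box
constraints on `p`, all nonpositive. -/
theorem mem_outerEllipsoid {Λ : Matrix (Fin d) (Fin d) ℝ} (hΛ : Λᵀ = Λ) {q : ℝ}
    {μ₁ ℓ : Fin d → ℝ} (hℓ : ∀ i, 0 < ℓ i) {Δ₁ : Matrix (Fin d) (Fin d) ℝ} {Δ₂ : Fin d → ℝ}
    {η₀ : ℝ} (hη₀ : 0 ≤ η₀) {η : Fin d → ℝ} (hη : ∀ i, 0 ≤ η i)
    (hlmi : (outerLMI Λ q μ₁ ℓ Δ₁ Δ₂ η₀ η).PosSemidef) {θ p : Fin d → ℝ}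
    (hp : ∀ i, |p i - μ₁ i| ≤ ℓ i / 2) (hθ : (θ - p) ⬝ᵥ (Λ *ᵥ (θ - p)) ≤ q) :
    θ ⬝ᵥ (Δ₁ *ᵥ θ) + 2 * (Δ₂ ⬝ᵥ θ) + deltaThree Δ₁ Δ₂ ≤ 0 := by
  have h := hlmi.dotProduct_mulVec_nonneg (Sum.elim (Sum.elim θ p) (fun _ => 1))
  rw [star_trivial, outerLMI, add_mulVec, add_mulVec, neg_mulVec, smul_mulVec, dotProduct_add,
    dotProduct_add, dotProduct_neg, dotProduct_smul, symBlock_quadratic, symBlock_quadratic,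
    symBlock_quadratic] at h
  have hsym : p ⬝ᵥ (Λ *ᵥ θ) = θ ⬝ᵥ (Λ *ᵥ p) := by
    rw [← hΛ, mulVec_transpose, dotProduct_comm, dotProduct_mulVec, hΛ]
  have hexp : (θ - p) ⬝ᵥ (Λ *ᵥ (θ - p)) =
      θ ⬝ᵥ (Λ *ᵥ θ) - 2 * (θ ⬝ᵥ (Λ *ᵥ p)) + p ⬝ᵥ (Λ *ᵥ p) := by
    rw [mulVec_sub, sub_dotProduct, dotProduct_sub, dotProduct_sub, hsym]
    ring
  have hW : p ⬝ᵥ (weightW ℓ η *ᵥ p) - 2 * ((weightW ℓ η *ᵥ μ₁) ⬝ᵥ p) +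
      μ₁ ⬝ᵥ (weightW ℓ η *ᵥ μ₁) ≤ ∑ i, η i := by
    simp only [weightW, dotProduct, mulVec_diagonal, Finset.mul_sum, ← Finset.sum_add_distrib,
      ← Finset.sum_sub_distrib]
    refine Finset.sum_le_sum fun i _ => ?_
    have h1 : (p i - μ₁ i) ^ 2 ≤ (ℓ i / 2) ^ 2 := by
      rw [← sq_abs]; gcongr; exact hp i
    have h2 : 0 < (ℓ i / 2) ^ 2 := by have := hℓ i; positivity
    calc _ = η i / (ℓ i / 2) ^ 2 * (p i - μ₁ i) ^ 2 := by ring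
      _ ≤ η i / (ℓ i / 2) ^ 2 * (ℓ i / 2) ^ 2 :=
        mul_le_mul_of_nonneg_left h1 (div_nonneg (hη i) h2.le)
      _ = η i := div_mul_cancel₀ _ h2.ne'
  simp only [zero_mulVec, dotProduct_zero, zero_dotProduct, neg_dotProduct, neg_mulVec,
    dotProduct_neg, smul_eq_mul] at h
  rw [hexp] at hθ
  have h3 := mul_le_mul_of_nonneg_left hθ hη₀
  linarith

end Ellipsoid

/-! ### Evaluation of polynomials and polynomial matrices -/

section Evaluation

variable {n : ℕ} {ι κ μ : Type*}

/-- Links the formal derivatives in `jacobian` with the analytic derivative of `V` along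
trajectories. -/
lemma hasFDerivAt_eval (p : Poly n) (x : Fin n → ℝ) :
    HasFDerivAt (fun y => MvPolynomial.eval y p)
      (∑ j, MvPolynomial.eval x (MvPolynomial.pderiv j p) •
        (ContinuousLinearMap.proj j : (Fin n → ℝ) →L[ℝ] ℝ)) x := by
  induction p using MvPolynomial.induction_on with
  | C a => simpa using hasFDerivAt_const a x
  | add p q hp hq =>
    simp only [map_add, add_smul, Finset.sum_add_distrib]
    exact hp.fun_add hq
  | mul_X p i hp =>
    have hX : HasFDerivAt (fun y : Fin n → ℝ => y i)
        (ContinuousLinearMap.proj i : (Fin n → ℝ) →L[ℝ] ℝ) x := hasFDerivAt_apply i x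
    have h := hp.fun_mul hX
    simp only [map_mul, MvPolynomial.eval_X]
    refine h.congr_fderiv ?_
    ext v
    simp [MvPolynomial.pderiv_X, Pi.single_apply, Finset.mul_sum, add_mul, Finset.sum_add_distrib,
      apply_ite]
    exact Finset.sum_congr rfl fun _ _ => by ring

lemma contDiff_eval {r : WithTop ℕ∞} (p : Poly n) :
    ContDiff ℝ r fun y : Fin n → ℝ => MvPolynomial.eval y p := by
  induction p using MvPolynomial.induction_on with
  | C a => simpa using contDiff_const
  | add p q hp hq => simpa using hp.add hq
  | mul_X p i hp => simpa using hp.mul (contDiff_apply ℝ ℝ i)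

lemma evalMat_mul [Fintype κ] (A : Matrix ι κ (Poly n)) (B : Matrix κ μ (Poly n))
    (x : Fin n → ℝ) : evalMat (A * B) x = evalMat A x * evalMat B x :=
  Matrix.map_mul

lemma evalMat_transpose (A : Matrix ι κ (Poly n)) (x : Fin n → ℝ) :
    evalMat Aᵀ x = (evalMat A x)ᵀ := rfl

lemma evalMat_constMat (A : Matrix ι κ ℝ) (x : Fin n → ℝ) :
    evalMat (constMat A : Matrix ι κ (Poly n)) x = A := by
  ext; simp [evalMat, constMat]

lemma evalMat_neg (A : Matrix ι κ (Poly n)) (x : Fin n → ℝ) :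
    evalMat (-A) x = -evalMat A x := by
  ext; simp [evalMat]

lemma evalMat_sub (A B : Matrix ι κ (Poly n)) (x : Fin n → ℝ) :
    evalMat (A - B) x = evalMat A x - evalMat B x := by
  ext; simp [evalMat]

lemma evalMat_zero (x : Fin n → ℝ) : evalMat (0 : Matrix ι κ (Poly n)) x = 0 := by
  ext; simp [evalMat]

lemma evalMat_one [DecidableEq ι] (x : Fin n → ℝ) :
    evalMat (1 : Matrix ι ι (Poly n)) x = 1 := by
  simp [evalMat]

lemma evalMat_smul (p : Poly n) (A : Matrix ι κ (Poly n)) (x : Fin n → ℝ) :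
    evalMat (p • A) x = MvPolynomial.eval x p • evalMat A x := by
  ext; simp [evalMat]

lemma evalVec_mulVec [Fintype κ] (A : Matrix ι κ (Poly n)) (v : κ → Poly n) (x : Fin n → ℝ) :
    evalVec (A *ᵥ v) x = evalMat A x *ᵥ evalVec v x := by
  ext i
  exact RingHom.map_mulVec (MvPolynomial.eval x) A v i

lemma IsSOSMatrix.dotProduct_evalMat_nonneg [Fintype ι] {A : Matrix ι ι (Poly n)}
    (hA : IsSOSMatrix A) (x : Fin n → ℝ) (v : ι → ℝ) : 0 ≤ v ⬝ᵥ (evalMat A x *ᵥ v) := by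
  obtain ⟨r, Q, rfl⟩ := hA
  rw [evalMat_mul, evalMat_transpose, ← mulVec_mulVec, dotProduct_mulVec, vecMul_transpose]
  exact Finset.sum_nonneg fun _ _ => mul_self_nonneg _

lemma le_dotProduct_evalMat [Fintype ι] [DecidableEq ι] {A : Matrix ι ι (Poly n)} {ε : ℝ}
    (hA : IsSOSMatrix (A - constMat (n := n) (Matrix.diagonal fun _ => ε))) (x : Fin n → ℝ)
    (v : ι → ℝ) : ε * (v ⬝ᵥ v) ≤ v ⬝ᵥ (evalMat A x *ᵥ v) := by
  have h := hA.dotProduct_evalMat_nonneg x v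
  rw [evalMat_sub, evalMat_constMat, sub_mulVec, dotProduct_sub] at h
  have h2 : v ⬝ᵥ (Matrix.diagonal (fun _ => ε) *ᵥ v) = ε * (v ⬝ᵥ v) := by
    simp only [dotProduct, mulVec_diagonal, Finset.mul_sum]
    exact Finset.sum_congr rfl fun i _ => by ring
  linarith

lemma IsSOS.eval_nonneg {p : Poly n} (hp : IsSOS p) (x : Fin n → ℝ) :
    0 ≤ MvPolynomial.eval x p := by
  simpa [evalMat, dotProduct, mulVec] using hp.dotProduct_evalMat_nonneg x fun _ => 1

end Evaluation

/-! ### Quadratic forms -/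

section QuadraticForm

variable {ι : Type*} [Fintype ι]

lemma exists_dotProduct_mulVec_le (P : Matrix ι ι ℝ) :
    ∃ b : ℝ, 0 < b ∧ ∀ v, v ⬝ᵥ (P *ᵥ v) ≤ b * (v ⬝ᵥ v) := by
  -- Any upper bound of the form serves; the `1` keeps it positive even for a zero or empty matrix.
  refine ⟨∑ i, ∑ j, |P i j| + 1, by positivity, fun v => ?_⟩
  have h0 : 0 ≤ v ⬝ᵥ v := Finset.sum_nonneg fun _ _ => mul_self_nonneg _
  have hi : ∀ i, v i ^ 2 ≤ v ⬝ᵥ v := by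
    intro i
    rw [sq]
    exact Finset.single_le_sum (f := fun i => v i * v i) (fun j _ => mul_self_nonneg _)
      (Finset.mem_univ i)
  have h1 : v ⬝ᵥ (P *ᵥ v) ≤ (∑ i, ∑ j, |P i j|) * (v ⬝ᵥ v) := by
    rw [dotProduct]
    simp only [mulVec, dotProduct.eq_1 (P _), Finset.mul_sum, Finset.sum_mul]
    refine Finset.sum_le_sum fun i _ => Finset.sum_le_sum fun j _ => ?_
    calc v i * (P i j * v j) ≤ |v i * (P i j * v j)| := le_abs_self _
      _ = |P i j| * (|v i| * |v j|) := by rw [abs_mul, abs_mul]; ring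
      _ ≤ |P i j| * (v ⬝ᵥ v) := by
        gcongr
        nlinarith [hi i, hi j, sq_abs (v i), sq_abs (v j), sq_nonneg (|v i| - |v j|)]
  linarith

/-- That `P ≤ b` implies `P² ≤ b P` is obtained without diagonalization, by testing `P` on `P y - b
y`. At `y = P⁻¹ z` it yields the lower bound `|z|² ≤ b zᵀ P⁻¹ z`. -/
lemma dotProduct_self_le_of_posSemidef {P : Matrix ι ι ℝ} (hP : P.PosSemidef) {b : ℝ}
    (hb : 0 < b) (hPb : ∀ v, v ⬝ᵥ (P *ᵥ v) ≤ b * (v ⬝ᵥ v)) (y : ι → ℝ) :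
    (P *ᵥ y) ⬝ᵥ (P *ᵥ y) ≤ b * (y ⬝ᵥ (P *ᵥ y)) := by
  set z := P *ᵥ y with hz
  have h := hP.dotProduct_mulVec_nonneg (z - b • y)
  have hsym : y ⬝ᵥ (P *ᵥ z) = z ⬝ᵥ z := by
    have hPt : Pᵀ = P := hP.isHermitian
    rw [dotProduct_mulVec, ← mulVec_transpose, hPt]
  rw [star_trivial, mulVec_sub, mulVec_smul, ← hz, sub_dotProduct, dotProduct_sub, dotProduct_sub,
    smul_dotProduct, smul_dotProduct, dotProduct_smul, dotProduct_smul, hsym] at h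
  simp only [smul_eq_mul] at h
  have h1 := hPb z
  have h2 : 0 ≤ b * (b * (y ⬝ᵥ z) - z ⬝ᵥ z) := by nlinarith
  have := nonneg_of_mul_nonneg_right h2 hb
  linarith

end QuadraticForm

/-! ### The closed loop -/

section ClosedLoop

variable {n nu nΘ m : ℕ} {𝒦 : Knowledge n nu nΘ}
  {f : (Fin nΘ → ℝ) → (Fin n → ℝ) → (Fin n → ℝ)}
  {B : (Fin nΘ → ℝ) → Matrix (Fin n) (Fin nu) (Poly n)} {R : (Fin n → ℝ) → (Fin n → ℝ)}

lemma Knowledge.IsSystemFamily.closedLoop_apply (hsys : 𝒦.IsSystemFamily f B R)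
    (θ : Fin nΘ → ℝ) (u : (Fin n → ℝ) → (Fin nu → ℝ)) (x : Fin n → ℝ) (i : Fin n) :
    closedLoop (f θ) (B θ) u x i = (𝒦.regressor x (u x) *ᵥ θ) i + R x i := by
  have h1 : (𝒦.regressor x (u x) *ᵥ θ) i =
      𝒦.aCoef θ i ⬝ᵥ evalVec (𝒦.zRow i) x + 𝒦.bCoef θ i ⬝ᵥ (evalMat (𝒦.G i) x *ᵥ u x) := by
    change (Sum.elim (evalVec (𝒦.zRow i) x) (evalMat (𝒦.G i) x *ᵥ u x) ᵥ* 𝒦.S i) ⬝ᵥ θ = _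
    rw [← dotProduct_mulVec, dotProduct_comm, dotProduct_block]
    rfl
  have h2 : (evalMat (B θ) x *ᵥ u x) i = 𝒦.bCoef θ i ⬝ᵥ (evalMat (𝒦.G i) x *ᵥ u x) := by
    rw [dotProduct_mulVec]
    change evalMat (B θ) x i ⬝ᵥ u x = _
    congr 1
    ext j
    simp [evalMat, hsys.input, vecMul, dotProduct]
  rw [closedLoop, Pi.add_apply, h1, h2, ← hsys.taylor, ← hsys.remainder θ i x, taylorRem]
  ring

/-- With `y = P⁻¹ z` one has `F_i P y = z_i` and `K y = u`, so `yᵀ L` lists the rows of the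
closed-loop regressor. This is why `P` and `K` enter `L` linearly although the feedback contains
`P⁻¹`. -/
lemma evalMat_gainRow_vecMul
    {β : Fin m → (Fin n → ℕ)} {F : ∀ i, Matrix (𝒦.A i) (Fin n ⊕ Fin m) (Poly n)}
    (hF : ∀ i, 𝒦.zRow i = F i *ᵥ zVec β) {P : Matrix (Fin n ⊕ Fin m) (Fin n ⊕ Fin m) ℝ}
    (hP : P.PosDef) (K : Matrix (Fin nu) (Fin n ⊕ Fin m) (Poly n)) (x : Fin n → ℝ)
    (i : Fin n) (l : Fin nΘ) :
    ((P⁻¹ *ᵥ evalVec (zVec β) x) ᵥ* evalMat (𝒦.gainRow F P K) x) (i, l) =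
      𝒦.regressor x (feedback β P K x) i l := by
  set y := P⁻¹ *ᵥ evalVec (zVec β) x with hy
  have hPy : P *ᵥ y = evalVec (zVec β) x := by
    rw [hy, mulVec_mulVec, mul_nonsing_inv _ ((isUnit_iff_isUnit_det _).1 hP.isUnit), one_mulVec]
  have h1 : (y ᵥ* evalMat (𝒦.gainRow F P K) x) (i, l) =
      (y ᵥ* evalMat (Matrix.transpose (Matrix.fromRows (F i * constMat (n := n) P) (𝒦.G i * K)) *
        constMat (n := n) (𝒦.S i)) x) l := rfl
  rw [h1, evalMat_mul, evalMat_transpose, evalMat_constMat, ← vecMul_vecMul, vecMul_transpose,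
    evalMat, fromRows_map, fromRows_mulVec]
  change (Sum.elim (evalMat (F i * constMat P) x *ᵥ y) (evalMat (𝒦.G i * K) x *ᵥ y) ᵥ* 𝒦.S i) l = _
  rw [evalMat_mul, evalMat_mul, evalMat_constMat, ← mulVec_mulVec, ← mulVec_mulVec, hPy,
    ← evalVec_mulVec, ← hF]
  rfl

end ClosedLoop

/-! ### The synthesis condition as a dissipation inequality -/

section Dissipation

variable {n nu nΘ m : ℕ} {𝒦 : Knowledge n nu nΘ}
  {β : Fin m → (Fin n → ℕ)} {F : ∀ i, Matrix (𝒦.A i) (Fin n ⊕ Fin m) (Poly n)}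
  {Ω : Matrix 𝒦.remIndices (Fin n ⊕ Fin m) (Poly n)}
  {Δ₁ : Matrix (Fin nΘ) (Fin nΘ) ℝ} {Δ₂ : Fin nΘ → ℝ}
  {P : Matrix (Fin n ⊕ Fin m) (Fin n ⊕ Fin m) ℝ}
  {K : Matrix (Fin nu) (Fin n ⊕ Fin m) (Poly n)} {τ₀ : Poly n} {τ : Fin n → Poly n}

lemma evalMat_outerMat_mulVec (x : Fin n → ℝ) (y : Fin n ⊕ Fin m → ℝ) (v : 𝒦.remIndices → ℝ)
    (w : Fin n × Fin nΘ → ℝ) :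
    evalMat (𝒦.outerMat β F Ω P K) x *ᵥ Sum.elim y (Sum.elim v w) =
      Sum.elim (Sum.elim (-(P *ᵥ ((evalMat Ω x)ᵀ *ᵥ v)) - evalMat (𝒦.gainRow F P K) x *ᵥ w) y)
        (Sum.elim (Sum.elim (-((evalMat (jacobian (zVec β)) x)ᵀ *ᵥ y)) v)
          (Sum.elim (-((evalMat (jacobian (zVec β)) x)ᵀ *ᵥ y)) w)) := by
  have hc : ∀ {a b c : Type} (A : Matrix a b (Poly n)) (B : Matrix a c (Poly n)),
      evalMat (fromCols A B) x = fromCols (evalMat A x) (evalMat B x) :=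
    fun A B => fromCols_map A B _
  have hr : ∀ {a b c : Type} (A : Matrix a c (Poly n)) (B : Matrix b c (Poly n)),
      evalMat (fromRows A B) x = fromRows (evalMat A x) (evalMat B x) :=
    fun A B => fromRows_map A B _
  simp only [Knowledge.outerMat, hc, hr, evalMat_neg, evalMat_mul, evalMat_transpose,
    evalMat_constMat, evalMat_zero, evalMat_one, fromRows_mulVec, fromCols_mulVec_sumElim,
    zero_mulVec, one_mulVec, neg_mulVec, zero_add, add_zero, ← mulVec_mulVec, ← sub_eq_add_neg]

lemma evalMat_kronCol_diagonal (x : Fin n → ℝ) (v : Fin nΘ → ℝ) :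
    evalMat (kronCol (Matrix.diagonal τ) v) x =
      Matrix.of fun p i => if p.1 = i then MvPolynomial.eval x (τ i) * v p.2 else 0 := by
  ext p i
  by_cases h : p.1 = i
  · subst h; simp [evalMat, kronCol, constMat]
  · simp [evalMat, kronCol, constMat, h]

lemma evalMat_diagonal_kronecker (x : Fin n → ℝ) (A : Matrix (Fin nΘ) (Fin nΘ) ℝ) :
    evalMat (Matrix.diagonal τ ⊗ₖ constMat (n := n) A) x =
      Matrix.of fun p q => if p.1 = q.1 then MvPolynomial.eval x (τ p.1) * A p.2 q.2 else 0 := by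
  ext p q
  by_cases h : p.1 = q.1
  · simp [evalMat, constMat, kroneckerMap_apply, h]
  · simp [evalMat, constMat, kroneckerMap_apply, h]

lemma innerMat_quadratic (x : Fin n → ℝ) (a y : Fin n ⊕ Fin m → ℝ) (r : Fin n → ℝ)
    (v : 𝒦.remIndices → ℝ) (w : Fin n × Fin nΘ → ℝ) :
    Sum.elim (Sum.elim a y) (Sum.elim (Sum.elim r v) (Sum.elim r w)) ⬝ᵥ
        (evalMat (𝒦.innerMat (m := m) τ₀ τ Δ₁ Δ₂) x *ᵥ
          Sum.elim (Sum.elim a y) (Sum.elim (Sum.elim r v) (Sum.elim r w))) =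
      2 * (y ⬝ᵥ a) + MvPolynomial.eval x τ₀ * (v ⬝ᵥ ((𝒦.D)⁻¹ *ᵥ v) - r ⬝ᵥ r) +
        ∑ i, MvPolynomial.eval x (τ i) * (deltaThree Δ₁ Δ₂ * r i ^ 2 -
          2 * (r i * (Δ₂ ⬝ᵥ fun l => w (i, l))) +
          (fun l => w (i, l)) ⬝ᵥ (Δ₁ *ᵥ fun l => w (i, l))) := by
  have hb : ∀ {a b c d : Type} (A : Matrix a c (Poly n)) (B : Matrix a d (Poly n))
      (C : Matrix b c (Poly n)) (D : Matrix b d (Poly n)), evalMat (fromBlocks A B C D) x =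
        fromBlocks (evalMat A x) (evalMat B x) (evalMat C x) (evalMat D x) :=
    fun A B C D => fromBlocks_map A B C D _
  have hdiag : r ⬝ᵥ (evalMat (deltaThree Δ₁ Δ₂ • Matrix.diagonal τ) x *ᵥ r) =
      ∑ i, MvPolynomial.eval x (τ i) * (deltaThree Δ₁ Δ₂ * r i ^ 2) := by
    have : evalMat (deltaThree Δ₁ Δ₂ • Matrix.diagonal τ) x =
        Matrix.diagonal fun i => deltaThree Δ₁ Δ₂ * MvPolynomial.eval x (τ i) := by
      ext i j
      by_cases h : i = j
      · subst h; simp [evalMat, MvPolynomial.smul_eval]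
      · simp [evalMat, h]
    simp only [this, dotProduct, mulVec_diagonal]
    exact Finset.sum_congr rfl fun i _ => by ring
  have hcol : w ⬝ᵥ (evalMat (kronCol (Matrix.diagonal τ) Δ₂) x *ᵥ r) =
      ∑ i, MvPolynomial.eval x (τ i) * (r i * (Δ₂ ⬝ᵥ fun l => w (i, l))) := by
    rw [evalMat_kronCol_diagonal]
    simp only [dotProduct, mulVec, of_apply, Fintype.sum_prod_type, ite_mul, zero_mul,
      Finset.sum_ite_eq, Finset.mem_univ, if_true, Finset.mul_sum]
    exact Finset.sum_congr rfl fun i _ => Finset.sum_congr rfl fun l _ => by ring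
  have hrow : r ⬝ᵥ ((evalMat (kronCol (Matrix.diagonal τ) Δ₂) x)ᵀ *ᵥ w) =
      ∑ i, MvPolynomial.eval x (τ i) * (r i * (Δ₂ ⬝ᵥ fun l => w (i, l))) := by
    rw [← hcol, mulVec_transpose, dotProduct_comm, dotProduct_mulVec]
  have hkron : w ⬝ᵥ (evalMat (Matrix.diagonal τ ⊗ₖ constMat (n := n) Δ₁) x *ᵥ w) =
      ∑ i, MvPolynomial.eval x (τ i) *
        ((fun l => w (i, l)) ⬝ᵥ (Δ₁ *ᵥ fun l => w (i, l))) := by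
    rw [evalMat_diagonal_kronecker]
    simp only [dotProduct, mulVec, of_apply, Fintype.sum_prod_type, ite_mul, zero_mul,
      Finset.mul_sum]
    refine Finset.sum_congr rfl fun i _ => Finset.sum_congr rfl fun l _ => ?_
    rw [Finset.sum_eq_single i (fun j _ hj => by simp [hj.symm]) (by simp)]
    exact Finset.sum_congr rfl fun l' _ => by simp; ring
  simp only [Knowledge.innerMat, hb, fromBlocks_mulVec, evalMat_zero, evalMat_one, evalMat_neg,
    evalMat_smul, evalMat_transpose, evalMat_constMat, Sum.elim_comp_inl, Sum.elim_comp_inr,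
    zero_mulVec, one_mulVec, neg_mulVec, smul_mulVec, zero_add, add_zero,
    dotProduct_block, dotProduct_add, dotProduct_neg, dotProduct_smul, hdiag, hcol, hrow, hkron,
    smul_eq_mul, dotProduct_comm a y]
  simp only [mul_add, mul_sub, Finset.sum_add_distrib, Finset.sum_sub_distrib]
  have h2 : ∑ i, MvPolynomial.eval x (τ i) * (2 * (r i * (Δ₂ ⬝ᵥ fun l => w (i, l)))) =
      2 * ∑ i, MvPolynomial.eval x (τ i) * (r i * (Δ₂ ⬝ᵥ fun l => w (i, l))) := by
    rw [Finset.mul_sum]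
    exact Finset.sum_congr rfl fun i _ => by ring
  rw [h2]
  ring

/-- A vector `v` with `ωᵀ v = s` and `vᵀ 𝒟⁻¹ v ≤ c` exists if `s² ≤ c ωᵀ 𝒟 ω`. -/
lemma exists_dotProduct_eq_of_sq_le (ω : 𝒦.remIndices → ℝ) {s c : ℝ} (hc : 0 ≤ c)
    (h : s ^ 2 ≤ c * (ω ⬝ᵥ (𝒦.D *ᵥ ω))) :
    ∃ v : 𝒦.remIndices → ℝ, ω ⬝ᵥ v = s ∧ v ⬝ᵥ ((𝒦.D)⁻¹ *ᵥ v) ≤ c := by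
  have hdet : IsUnit (𝒦.D).det := by
    rw [Knowledge.D, det_diagonal, isUnit_iff_ne_zero]
    exact Finset.prod_ne_zero_iff.2 fun ρ _ => (Knowledge.dDiag_pos ρ).ne'
  -- In the degenerate case `s = 0` is forced and `v = 0` works. Otherwise the witness `(s / q) 𝒟 ω`
  -- minimizes `vᵀ 𝒟⁻¹ v` subject to `ωᵀ v = s`, with minimum `s² / q`.
  by_cases h0 : ω ⬝ᵥ (𝒦.D *ᵥ ω) = 0
  · rw [h0, mul_zero] at h
    have hs : s = 0 := by nlinarith [sq_nonneg s, pow_eq_zero_iff (two_ne_zero) (M₀ := ℝ) (a := s)]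
    exact ⟨0, by simp [hs], by simpa using hc⟩
  · set q := ω ⬝ᵥ (𝒦.D *ᵥ ω) with hq
    have hq0 : 0 < q := by
      refine lt_of_le_of_ne ?_ (Ne.symm h0)
      simp only [hq, Knowledge.D, dotProduct, mulVec_diagonal]
      refine Finset.sum_nonneg fun ρ _ => ?_
      have := (Knowledge.dDiag_pos ρ).le
      nlinarith [mul_nonneg this (mul_self_nonneg (ω ρ))]
    refine ⟨(s / q) • (𝒦.D *ᵥ ω), ?_, ?_⟩
    · rw [dotProduct_smul, ← hq, smul_eq_mul, div_mul_cancel₀ _ h0]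
    · rw [mulVec_smul, mulVec_mulVec, nonsing_inv_mul _ hdet, one_mulVec, smul_dotProduct,
        dotProduct_smul, dotProduct_comm, ← hq, smul_eq_mul, smul_eq_mul]
      have : s / q * (s / q * q) = s ^ 2 / q := by field_simp
      rw [this, div_le_iff₀ hq0]
      exact h

/-- The left-hand side is the derivative of `zᵀ P⁻¹ z` along the closed loop. A suitable test vector
for `Ψ` turns its first block into minus this derivative and both multiplier blocks into nonpositive
terms. -/
theorem dissipation {f : (Fin nΘ → ℝ) → (Fin n → ℝ) → (Fin n → ℝ)}
    {B : (Fin nΘ → ℝ) → Matrix (Fin n) (Fin nu) (Poly n)} {R : (Fin n → ℝ) → (Fin n → ℝ)}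
    (hsys : 𝒦.IsSystemFamily f B R) (hF : ∀ i, 𝒦.zRow i = F i *ᵥ zVec β)
    (hΩ : 𝒦.omegaVec = Ω *ᵥ zVec β) (hP : P.PosDef)
    (hτ₀ : ∀ x, 0 ≤ MvPolynomial.eval x τ₀) (hτ : ∀ i x, 0 ≤ MvPolynomial.eval x (τ i))
    {ε : ℝ} (hε : 0 ≤ ε) (hΨ : IsSOSMatrix
      (𝒦.Psi β F Ω Δ₁ Δ₂ P K τ₀ τ - constMat (n := n) (Matrix.diagonal fun _ => ε)))
    {θ : Fin nΘ → ℝ} (hθ : θ ⬝ᵥ (Δ₁ *ᵥ θ) + 2 * (Δ₂ ⬝ᵥ θ) + deltaThree Δ₁ Δ₂ ≤ 0)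
    (x : Fin n → ℝ) :
    2 * ((P⁻¹ *ᵥ evalVec (zVec β) x) ⬝ᵥ (evalMat (jacobian (zVec β)) x *ᵥ
        closedLoop (f θ) (B θ) (feedback β P K) x)) ≤
      -(ε * ((P⁻¹ *ᵥ evalVec (zVec β) x) ⬝ᵥ (P⁻¹ *ᵥ evalVec (zVec β) x))) := by
  set y := P⁻¹ *ᵥ evalVec (zVec β) x with hy
  set r : Fin n → ℝ := -((evalMat (jacobian (zVec β)) x)ᵀ *ᵥ y) with hr
  set ω := evalVec 𝒦.omegaVec x with hω
  have hPy : P *ᵥ y = evalVec (zVec β) x := by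
    rw [hy, mulVec_mulVec, mul_nonsing_inv _ ((isUnit_iff_isUnit_det _).1 hP.isUnit), one_mulVec]
  have hPt : Pᵀ = P := hP.isHermitian
  -- `R` need not be a polynomial; at the fixed `x` only the scalar `rᵀ R` matters, and `v` encodes
  -- it. Cauchy–Schwarz with the bound `|R|² ≤ ωᵀ 𝒟 ω` makes this compatible with `vᵀ 𝒟⁻¹ v ≤ rᵀ r`.
  obtain ⟨v, hv, hvD⟩ := exists_dotProduct_eq_of_sq_le (𝒦 := 𝒦) ω (s := -(r ⬝ᵥ R x))
    (c := r ⬝ᵥ r) (Finset.sum_nonneg fun _ _ => mul_self_nonneg _) (by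
      have h1 : (r ⬝ᵥ R x) ^ 2 ≤ (∑ i, r i ^ 2) * ∑ i, R x i ^ 2 :=
        Finset.sum_mul_sq_le_sq_mul_sq _ _ _
      have h2 : ω ⬝ᵥ (𝒦.D *ᵥ ω) = ∑ ρ, 𝒦.dDiag ρ.1 * ω ρ ^ 2 := by
        simp only [Knowledge.D, dotProduct, mulVec_diagonal]
        exact Finset.sum_congr rfl fun ρ _ => by ring
      have h3 : r ⬝ᵥ r = ∑ i, r i ^ 2 := by simp [dotProduct, sq]
      rw [neg_sq, h2, h3]
      exact h1.trans (mul_le_mul_of_nonneg_left (hsys.sum_sq_remainder_le x)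
        (Finset.sum_nonneg fun _ _ => sq_nonneg _)))
  set w : Fin n × Fin nΘ → ℝ := fun p => -(r p.1 * θ p.2) with hw
  have hmain := le_dotProduct_evalMat hΨ x (Sum.elim y (Sum.elim v w))
  rw [Knowledge.Psi, evalMat_mul, evalMat_mul, evalMat_transpose, ← mulVec_mulVec,
    ← mulVec_mulVec, dotProduct_mulVec, vecMul_transpose, evalMat_outerMat_mulVec, ← hr,
    innerMat_quadratic] at hmain
  have hnorm : y ⬝ᵥ y ≤ Sum.elim y (Sum.elim v w) ⬝ᵥ Sum.elim y (Sum.elim v w) := by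
    rw [dotProduct_block (Sum.elim y _), Sum.elim_comp_inl, Sum.elim_comp_inr]
    exact le_add_of_nonneg_right (Finset.sum_nonneg fun _ _ => mul_self_nonneg _)
  have hrem : y ⬝ᵥ (P *ᵥ ((evalMat Ω x)ᵀ *ᵥ v)) = -(r ⬝ᵥ R x) := by
    rw [dotProduct_mulVec, ← mulVec_transpose, hPt, hPy, dotProduct_mulVec, vecMul_transpose,
      ← evalVec_mulVec, ← hΩ, hv]
  have hgain : y ⬝ᵥ (evalMat (𝒦.gainRow F P K) x *ᵥ w) =
      -(r ⬝ᵥ (𝒦.regressor x (feedback β P K x) *ᵥ θ)) := by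
    rw [dotProduct_mulVec]
    simp only [dotProduct, mulVec, Fintype.sum_prod_type, hw, Finset.mul_sum,
      ← Finset.sum_neg_distrib]
    refine Finset.sum_congr rfl fun i _ => Finset.sum_congr rfl fun l _ => ?_
    rw [hy, evalMat_gainRow_vecMul hF hP K x i l]
    ring
  have hell : ∑ i, MvPolynomial.eval x (τ i) * (deltaThree Δ₁ Δ₂ * r i ^ 2 -
      2 * (r i * (Δ₂ ⬝ᵥ fun l => w (i, l))) +
      (fun l => w (i, l)) ⬝ᵥ (Δ₁ *ᵥ fun l => w (i, l))) ≤ 0 := by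
    refine Finset.sum_nonpos fun i _ => mul_nonpos_of_nonneg_of_nonpos (hτ i x) ?_
    -- Each block of `w` is a multiple of `θ`, so the `i`-th summand is `τ_i r_i²` times the outer
    -- quadratic at `θ`.
    have hwi : (fun l => w (i, l)) = (-r i) • θ := by
      ext l; simp [hw]
    rw [hwi, dotProduct_smul, mulVec_smul, smul_dotProduct, dotProduct_smul]
    simp only [smul_eq_mul]
    nlinarith [mul_nonneg (sq_nonneg (r i)) (neg_nonneg.2 hθ)]
  have hloop : closedLoop (f θ) (B θ) (feedback β P K) x =
      𝒦.regressor x (feedback β P K x) *ᵥ θ + R x :=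
    funext fun i => hsys.closedLoop_apply θ _ x i
  have hJ : y ⬝ᵥ (evalMat (jacobian (zVec β)) x *ᵥ
      closedLoop (f θ) (B θ) (feedback β P K) x) =
      -(r ⬝ᵥ (𝒦.regressor x (feedback β P K x) *ᵥ θ)) - r ⬝ᵥ R x := by
    rw [hloop, dotProduct_mulVec, ← mulVec_transpose, hr, neg_dotProduct, neg_dotProduct,
      dotProduct_add]
    ring
  rw [dotProduct_sub, dotProduct_neg, hrem, hgain] at hmain
  have h1 := mul_le_mul_of_nonneg_left hnorm hε
  have h2 := mul_nonneg (hτ₀ x) (sub_nonneg.2 hvD)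
  rw [hJ]
  nlinarith

end Dissipation

/-! ### Stability of the closed loop -/

section Stability

variable {n nu nΘ m : ℕ}

lemma IsSOS.eval_nonneg_of_sub_C {p : Poly n} {ε : ℝ} (hε : 0 < ε)
    (hp : IsSOS (p - MvPolynomial.C ε)) (x : Fin n → ℝ) : 0 ≤ MvPolynomial.eval x p := by
  have := hp.eval_nonneg x
  rw [map_sub, MvPolynomial.eval_C] at this
  linarith

lemma evalVec_zVec_zero {β : Fin m → (Fin n → ℕ)} (hβ : ∀ l, β l ≠ 0) :
    evalVec (zVec β) 0 = 0 := by
  ext a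
  rcases a with j | l
  · simp [evalVec, zVec]
  · obtain ⟨j, hj⟩ := Function.ne_iff.1 (hβ l)
    simp only [evalVec, zVec, Sum.elim_inr, monom, map_prod, map_pow, MvPolynomial.eval_X,
      Pi.zero_apply]
    exact Finset.prod_eq_zero (Finset.mem_univ j) (zero_pow hj)

lemma contDiff_evalVec {ι : Type*} {r : WithTop ℕ∞} (v : ι → Poly n) (a : ι) :
    ContDiff ℝ r fun x => evalVec v x a :=
  contDiff_eval _

lemma contDiff_evalMat_mulVec {ι κ : Type*} [Fintype κ] {r : WithTop ℕ∞}
    (A : Matrix ι κ (Poly n)) {v : (Fin n → ℝ) → κ → ℝ} (hv : ∀ a, ContDiff ℝ r fun x => v x a)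
    (i : ι) : ContDiff ℝ r fun x => (evalMat A x *ᵥ v x) i := by
  simp only [mulVec, dotProduct]
  exact ContDiff.sum fun j _ => (contDiff_eval (A i j)).mul (hv j)

lemma contDiff_closedLoop {f : (Fin n → ℝ) → (Fin n → ℝ)} {r : WithTop ℕ∞}
    (hf : ContDiff ℝ r f) (B : Matrix (Fin n) (Fin nu) (Poly n)) (β : Fin m → (Fin n → ℕ))
    (P : Matrix (Fin n ⊕ Fin m) (Fin n ⊕ Fin m) ℝ)
    (K : Matrix (Fin nu) (Fin n ⊕ Fin m) (Poly n)) :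
    ContDiff ℝ r (closedLoop f B (feedback β P K)) := by
  refine contDiff_pi.2 fun i => (contDiff_pi.1 hf i).add (contDiff_evalMat_mulVec B ?_ i)
  refine contDiff_evalMat_mulVec K fun a => ?_
  simp only [mulVec, dotProduct]
  exact ContDiff.sum fun b _ => contDiff_const.mul (contDiff_evalVec _ b)

lemma hasFDerivAt_evalVec_quadratic {ι : Type*} [Fintype ι] (z : ι → Poly n) (Q : Matrix ι ι ℝ)
    (hQ : Qᵀ = Q) (x : Fin n → ℝ) :
    DifferentiableAt ℝ (fun x => evalVec z x ⬝ᵥ (Q *ᵥ evalVec z x)) x ∧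
    ∀ v, fderiv ℝ (fun x => evalVec z x ⬝ᵥ (Q *ᵥ evalVec z x)) x v =
      2 * ((Q *ᵥ evalVec z x) ⬝ᵥ (evalMat (jacobian z) x *ᵥ v)) := by
  have hz : ∀ a, HasFDerivAt (fun x => evalVec z x a)
      (∑ j, MvPolynomial.eval x (MvPolynomial.pderiv j (z a)) •
        (ContinuousLinearMap.proj j : (Fin n → ℝ) →L[ℝ] ℝ)) x := fun a => hasFDerivAt_eval (z a) x
  have hV := HasFDerivAt.fun_sum (u := Finset.univ) fun a _ =>
    (hz a).fun_mul (HasFDerivAt.fun_sum (u := Finset.univ) fun b _ => (hz b).const_mul (Q a b))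
  have hV' : HasFDerivAt (fun x => evalVec z x ⬝ᵥ (Q *ᵥ evalVec z x)) _ x := hV
  refine ⟨hV'.differentiableAt, fun v => ?_⟩
  have hJ : ∀ a, (∑ j, MvPolynomial.eval x (MvPolynomial.pderiv j (z a)) •
      (ContinuousLinearMap.proj j : (Fin n → ℝ) →L[ℝ] ℝ)) v =
      (evalMat (jacobian z) x *ᵥ v) a := by
    intro a
    simp [mulVec, dotProduct, evalMat, jacobian]
  have h1 : fderiv ℝ (fun x => evalVec z x ⬝ᵥ (Q *ᵥ evalVec z x)) x v =
      evalVec z x ⬝ᵥ (Q *ᵥ (evalMat (jacobian z) x *ᵥ v)) +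
        (Q *ᵥ evalVec z x) ⬝ᵥ (evalMat (jacobian z) x *ᵥ v) := by
    rw [hV'.fderiv]
    simp only [_root_.sum_apply, _root_.add_apply,
      _root_.smul_apply, smul_eq_mul] at hJ ⊢
    simp only [hJ, Finset.sum_add_distrib]
    rfl
  rw [h1, dotProduct_mulVec, ← mulVec_transpose, hQ]
  ring

/-- One constant `b` with `P ≤ b` gives both Lyapunov estimates for `V = zᵀ P⁻¹ z`: `V ≥ |z|² / b ≥
‖x‖² / b`, because `x` is part of `z`, and `V = yᵀ P y ≤ b |y|²`, which turns the decay `-ε |y|²`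
into `-(ε / b) V`. -/
theorem globallyAsymptoticallyStable_closedLoop {𝒦 : Knowledge n nu nΘ}
    {β : Fin m → (Fin n → ℕ)} (hβ : ∀ l, β l ≠ 0)
    {F : ∀ i, Matrix (𝒦.A i) (Fin n ⊕ Fin m) (Poly n)}
    {Ω : Matrix 𝒦.remIndices (Fin n ⊕ Fin m) (Poly n)}
    {Δ₁ : Matrix (Fin nΘ) (Fin nΘ) ℝ} {Δ₂ : Fin nΘ → ℝ}
    {P : Matrix (Fin n ⊕ Fin m) (Fin n ⊕ Fin m) ℝ}
    {K : Matrix (Fin nu) (Fin n ⊕ Fin m) (Poly n)} {τ₀ : Poly n} {τ : Fin n → Poly n}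
    {f : (Fin nΘ → ℝ) → (Fin n → ℝ) → (Fin n → ℝ)}
    {B : (Fin nΘ → ℝ) → Matrix (Fin n) (Fin nu) (Poly n)} {R : (Fin n → ℝ) → (Fin n → ℝ)}
    (hsys : 𝒦.IsSystemFamily f B R) (hF : ∀ i, 𝒦.zRow i = F i *ᵥ zVec β)
    (hΩ : 𝒦.omegaVec = Ω *ᵥ zVec β) (hP : P.PosDef)
    (hτ₀ : ∀ x, 0 ≤ MvPolynomial.eval x τ₀) (hτ : ∀ i x, 0 ≤ MvPolynomial.eval x (τ i))
    {ε : ℝ} (hε : 0 < ε) (hΨ : IsSOSMatrix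
      (𝒦.Psi β F Ω Δ₁ Δ₂ P K τ₀ τ - constMat (n := n) (Matrix.diagonal fun _ => ε)))
    {θ : Fin nΘ → ℝ} (hθ : θ ⬝ᵥ (Δ₁ *ᵥ θ) + 2 * (Δ₂ ⬝ᵥ θ) + deltaThree Δ₁ Δ₂ ≤ 0) :
    GloballyAsymptoticallyStable (closedLoop (f θ) (B θ) (feedback β P K)) := by
  have hz0 := evalVec_zVec_zero hβ
  obtain ⟨b, hb, hPb⟩ := exists_dotProduct_mulVec_le P
  have hQt : (P⁻¹)ᵀ = P⁻¹ := hP.inv.isHermitian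
  have hPy : ∀ x, P *ᵥ (P⁻¹ *ᵥ evalVec (zVec β) x) = evalVec (zVec β) x := fun x => by
    rw [mulVec_mulVec, mul_nonsing_inv _ ((isUnit_iff_isUnit_det _).1 hP.isUnit), one_mulVec]
  refine globallyAsymptoticallyStable_of_lyapunov
    (V := fun x => evalVec (zVec β) x ⬝ᵥ (P⁻¹ *ᵥ evalVec (zVec β) x)) (a := b⁻¹) (c := ε / b)
    (contDiff_closedLoop ((hsys.contDiff θ).of_le (by simp)) _ _ _ _) ?_
    (fun x => (hasFDerivAt_evalVec_quadratic _ _ hQt x).1) (by simp [hz0]) (by positivity)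
    (by positivity) (fun x => ?_) (fun x => ?_)
  · simp [closedLoop, feedback, hsys.map_zero, hz0]
  · have h1 := dotProduct_self_le_of_posSemidef hP.posSemidef hb hPb
      (P⁻¹ *ᵥ evalVec (zVec β) x)
    rw [hPy, dotProduct_comm (P⁻¹ *ᵥ _)] at h1
    have h2 : ‖x‖ ^ 2 ≤ evalVec (zVec β) x ⬝ᵥ evalVec (zVec β) x := by
      have h3 : ∀ j, ‖x j‖ ^ 2 ≤ evalVec (zVec β) x ⬝ᵥ evalVec (zVec β) x := by
        intro j
        have h4 : x j = evalVec (zVec β) x (Sum.inl j) := by simp [evalVec, zVec]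
        rw [Real.norm_eq_abs, sq_abs, sq, h4]
        exact Finset.single_le_sum (f := fun a => evalVec (zVec β) x a * evalVec (zVec β) x a)
          (fun _ _ => mul_self_nonneg _) (Finset.mem_univ (Sum.inl j))
      have h5 : 0 ≤ evalVec (zVec β) x ⬝ᵥ evalVec (zVec β) x :=
        Finset.sum_nonneg fun _ _ => mul_self_nonneg _
      rw [← Real.le_sqrt (norm_nonneg _) h5]
      refine (pi_norm_le_iff_of_nonneg (Real.sqrt_nonneg _)).2 fun j => ?_
      exact Real.le_sqrt_of_sq_le (h3 j)
    rw [inv_mul_le_iff₀ hb]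
    exact h2.trans h1
  · rw [(hasFDerivAt_evalVec_quadratic _ _ hQt x).2]
    refine (dissipation hsys hF hΩ hP hτ₀ hτ hε.le hΨ hθ x).trans ?_
    have h1 := hPb (P⁻¹ *ᵥ evalVec (zVec β) x)
    rw [hPy, dotProduct_comm] at h1
    have h2 := mul_le_mul_of_nonneg_left h1 (div_nonneg hε.le hb.le)
    rw [← mul_assoc, div_mul_cancel₀ _ hb.ne'] at h2
    linarith

end Stability

end TaylorSynthesis

theorem theorem2 {n nu nΘ N m : ℕ}
    -- prior knowledge, samples, noise level and credibility level
    (𝒦 : TaylorSynthesis.Knowledge n nu nΘ) (data : TaylorSynthesis.Samples n nu N)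
    (σ : ℝ) (hσ : 0 < σ) (δ : ℝ) (hδ₀ : 0 < δ) (hδ₁ : δ < 1)
    -- the unknown system as a function of its unknown coefficients, with Taylor remainder `R`
    (f : (Fin nΘ → ℝ) → (Fin n → ℝ) → (Fin n → ℝ))
    (B : (Fin nΘ → ℝ) → Matrix (Fin n) (Fin nu) (TaylorSynthesis.Poly n))
    (R : (Fin n → ℝ) → (Fin n → ℝ)) (hsys : 𝒦.IsSystemFamily f B R)
    -- the ellipsoidal set-membership exists
    (hpe : (𝒦.gram data).PosDef)
    (ℓ : Fin nΘ → ℝ) (hℓ : ∀ i, 0 < ℓ i)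
    (hℓ_edge : ∀ i, 𝒦.edgeLength data σ i ≠ 0 → ℓ i = 𝒦.edgeLength data σ i)
    (Δ₁ : Matrix (Fin nΘ) (Fin nΘ) ℝ) (hΔ₁ : Δ₁.PosDef) (Δ₂ : Fin nΘ → ℝ)
    (η₀ : ℝ) (hη₀ : 0 ≤ η₀) (η : Fin nΘ → ℝ) (hη : ∀ i, 0 ≤ η i)
    (hellipsoid : (TaylorSynthesis.outerLMI (𝒦.precision data σ)
      (TaylorSynthesis.chiSquaredQuantile nΘ δ) (𝒦.muOne data σ) ℓ Δ₁ Δ₂ η₀ η).PosSemidef)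
    -- the monomials `z`, with `z 0 = 0`, and the factorizations `z_i = F_i z` and `ω = Ω z`
    (β : Fin m → (Fin n → ℕ)) (hβ : ∀ l, β l ≠ 0)
    (F : ∀ i, Matrix (𝒦.A i) (Fin n ⊕ Fin m) (TaylorSynthesis.Poly n))
    (hF : ∀ i, 𝒦.zRow i = F i *ᵥ TaylorSynthesis.zVec β)
    (Ω : Matrix 𝒦.remIndices (Fin n ⊕ Fin m) (TaylorSynthesis.Poly n))
    (hΩ : 𝒦.omegaVec = Ω *ᵥ TaylorSynthesis.zVec β)
    -- the solution of the synthesis problem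
    (P : Matrix (Fin n ⊕ Fin m) (Fin n ⊕ Fin m) ℝ) (hP : P.PosDef)
    (K : Matrix (Fin nu) (Fin n ⊕ Fin m) (TaylorSynthesis.Poly n))
    (τ₀ : TaylorSynthesis.Poly n) (τ : Fin n → TaylorSynthesis.Poly n)
    (hτ : ∃ ετ : ℝ, 0 < ετ ∧ TaylorSynthesis.IsSOS (τ₀ - MvPolynomial.C ετ) ∧
      ∀ i, TaylorSynthesis.IsSOS (τ i - MvPolynomial.C ετ))
    (hΨ : ∃ ε : ℝ, 0 < ε ∧ TaylorSynthesis.IsSOSMatrix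
      (𝒦.Psi β F Ω Δ₁ Δ₂ P K τ₀ τ - TaylorSynthesis.constMat (n := n) (Matrix.diagonal fun _ => ε))) :
    IsProbabilityMeasure (𝒦.posterior data σ R) ∧
    ∃ E : Set (Fin nΘ → ℝ), MeasurableSet E ∧
      ENNReal.ofReal δ ≤ 𝒦.posterior data σ R E ∧
      ∀ θ ∈ E, TaylorSynthesis.GloballyAsymptoticallyStable
        (TaylorSynthesis.closedLoop (f θ) (B θ) (TaylorSynthesis.feedback β P K)) := by
  obtain ⟨ετ, hετ, hτ₀, hτi⟩ := hτ
  obtain ⟨ε, hε, hΨ⟩ := hΨ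
  obtain ⟨hprob, hlevel⟩ :=
    TaylorSynthesis.Knowledge.posterior_ellipsoid (R := R) hσ hpe hδ₀ hδ₁
  -- The event is the credible ellipsoid around the true posterior mean. It depends on the unknown
  -- `R`, but every `θ` in it also lies in the known outer ellipsoid.
  refine ⟨hprob, _, ?_, hlevel, fun θ hθ => ?_⟩
  · refine (isClosed_le ?_ continuous_const).measurableSet
    fun_prop
  · have hcentre : ∀ i, |𝒦.posteriorMean data σ R i - 𝒦.muOne data σ i| ≤ ℓ i / 2 := by
      intro i
      have h := TaylorSynthesis.Knowledge.abs_posteriorMean_sub_le (data := data) (σ := σ)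
        (fun x i => hsys.abs_remainder_le_sqrt x i) i
      -- A zero edge forces the two centres to agree in this entry, so any positive replacement for
      -- the edge length is admissible.
      by_cases h0 : 𝒦.edgeLength data σ i = 0
      · rw [h0, zero_div] at h
        exact h.trans (half_pos (hℓ i)).le
      · rwa [hℓ_edge i h0]
    exact TaylorSynthesis.globallyAsymptoticallyStable_closedLoop hβ hsys hF hΩ hP
      (fun x => hτ₀.eval_nonneg_of_sub_C hετ x) (fun i x => (hτi i).eval_nonneg_of_sub_C hετ x)
      hε hΨ (TaylorSynthesis.mem_outerEllipsoid
        (TaylorSynthesis.Knowledge.posDef_precision hσ hpe).isHermitian hℓ hη₀ hη hellipsoid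
        hcentre hθ)
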